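/- Let $\mathbb T=\mathbb R^2/\mathbb Z^2$ and let $S$ be the set of positive integers that are sums of two integer squares. For $n\in S$ put $\Lambda_n=\{\lambda\in\mathbb Z^2:|\lambda|^2=n\}$, $\mathcal N_n=|\Lambda_n|$ and $r_n(x)=\mathcal N_n^{-1}\sum_{\lambda\in\Lambda_n}\cos(2\pi\langle\lambda,x\rangle)$. Let $(a_\lambda)_{\lambda\in\mathbb Z^2\setminus\{0\}}$ be standard complex Gaussian random variables (real and imaginary parts independent, centered, of variance $1/2$) on a probability space $(\Omega,\mathcal F,\mathbb P)$, independent except for the relations $\overline{a_\lambda}=a_{-\lambda}$, and let $$T_n(x)=\mathcal N_n^{-1/2}\sum_{\lambda\in\Lambda_n}a_\lambda e^{2\pi i\langle\lambda,x\rangle},\qquad x\in\mathbb T,$$ be the arithmetic random wave, a real Gaussian field with covariance $\mathbb E[T_n(x)T_n(y)]=r_n(x-y)$. Let $$\mathcal Z_n=\lim_{\varepsilon\to0^+}\frac1{2\varepsilon}\,\mathrm{meas}\{x\in\mathbb T:|T_n(x)|<\varepsilon\}$$ (limit in probability) be the Leray measure of its zero set. Let $\mathbf A$ be the closure in $L^2(\mathbb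 P)$ of the real linear span of the variables $z a_\lambda+\overline z a_{-\lambda}$ ($\lambda\neq0$, $z\in\mathbb C$). For $q\ge0$ let $C_q$, the $q$-th Wiener chaos, be the closure in $L^2(\mathbb P)$ of the real linear span of the products $H_{p_1}(\xi_1)\cdots H_{p_k}(\xi_k)$ with $k\ge1$, $p_1+\dots+p_k=q$ and $(\xi_1,\dots,\xi_k)$ a standard Gaussian vector with entries in $\mathbf A$, where $H_p$ is the $p$-th (probabilists') Hermite polynomial, and let $\mathcal Z_n[q]$ be the orthogonal projection of $\mathcal Z_n$ onto $C_q$. Then for every $n\in S$ the limit $\mathcal Z_n$ exists and lies in $L^2(\mathbb P)$, and $$\mathrm{Var}(\mathcal Z_n[2])=\frac1{4\pi\mathcal N_n}.$$ For every $K\ge2$ there is a constant $c_K$, depending only on $K$, such that for all $n\in S$ $$\sum_{q\ge K}\mathrm{Var}(\mathcal Z_n[2q])\le c_K\int_{\mathbb T}r_n(x)^{2K}\,dx .$$ In particular there is an absolute constant $c$ such that $\sum_{q\ge2}\mathrm{Var}(\mathcal Z_n[2q])\le c\,\mathcal N_n^{-2}$ for all $n\in S$. Consequently, with an absolute implied constant,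 for all $n\in S$, $$\mathrm{Var}(\mathcal Z_n)=\frac1{4\pi\mathcal N_n}+O\left(\frac1{\mathcal N_n^2}\right).$$ -/

import Mathlib

open MeasureTheory ProbabilityTheory Filter Topology
open scoped ENNReal NNReal ComplexConjugate

noncomputable section

namespace ArithmeticWave

/-- The flat torus `ℝ² / ℤ²`, with its Lebesgue measure `volume` of total mass one. -/
abbrev Torus : Type := UnitAddTorus (Fin 2)

/-- The set of integers that are sums of two integer squares (all of them are nonnegative). -/
def sumsOfTwoSquares : Set ℕ := {n | ∃ a b : ℤ, (n : ℤ) = a ^ 2 + b ^ 2}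

/-- The lattice points on the circle of radius `√n` centred at the origin. -/
def latticePoints (n : ℕ) : Finset (Fin 2 → ℤ) :=
  (Fintype.piFinset fun _ => Finset.Icc (-(n : ℤ)) n).filter fun l => l 0 ^ 2 + l 1 ^ 2 = n

/-- The box in the definition of `latticePoints` loses nothing. -/
theorem mem_latticePoints (n : ℕ) (l : Fin 2 → ℤ) :
    l ∈ latticePoints n ↔ l 0 ^ 2 + l 1 ^ 2 = n := by
  simp only [latticePoints, Finset.mem_filter, Fintype.mem_piFinset, Finset.mem_Icc,
    and_iff_right_iff_imp, Fin.forall_fin_two]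
  intro h
  refine ⟨⟨?_, ?_⟩, ?_, ?_⟩ <;>
    nlinarith [sq_nonneg (l 0), sq_nonneg (l 1), Int.le_self_sq (l 0), Int.le_self_sq (l 1),
      Int.le_self_sq (-(l 0)), Int.le_self_sq (-(l 1))]

/-- The number of lattice points on the circle of radius `√n`, which is the dimension of the
eigenspace of the Laplacian for the eigenvalue `4π²n`. -/
def latticeCount (n : ℕ) : ℕ := (latticePoints n).card

/-- The covariance function `x ↦ N⁻¹ ∑ cos (2π⟨l, x⟩)` of the arithmetic random wave, the sum
being over the lattice points `l` of norm `√n`; here `UnitAddTorus.mFourier l x` is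
`exp (2πi⟨l, x⟩)`. -/
def waveCov (n : ℕ) (x : Torus) : ℝ :=
  (latticeCount n : ℝ)⁻¹ * ∑ l ∈ latticePoints n, (UnitAddTorus.mFourier l x).re

/-- A set containing exactly one of `l`, `-l` for every nonzero lattice point `l`. -/
def halfLattice : Set (Fin 2 → ℤ) := {l | 0 < l 1 ∨ (l 1 = 0 ∧ 0 < l 0)}

variable {Ω : Type*}

/-- The arithmetic random wave `T_n(x) = N^{-1/2} ∑ a_l exp (2πi⟨l, x⟩)`. The sum is almost surely
real, because `conj (a_l) = a_{-l}`; `re` only serves to get a value in `ℝ`. -/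
def wave (a : (Fin 2 → ℤ) → Ω → ℂ) (n : ℕ) (x : Torus) (ω : Ω) : ℝ :=
  (((Real.sqrt (latticeCount n) : ℂ))⁻¹ *
    ∑ l ∈ latticePoints n, a l ω * UnitAddTorus.mFourier l x).re

/-- The approximation `(2ε)⁻¹ meas {x : |T_n(x)| < ε}` of the Leray measure. -/
def lerayApprox (a : (Fin 2 → ℤ) → Ω → ℂ) (n : ℕ) (ε : ℝ) (ω : Ω) : ℝ :=
  (2 * ε)⁻¹ * (volume : Measure Torus).real {x | |wave a n x ω| < ε}

variable [MeasurableSpace Ω]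

/-- A family of standard complex Gaussian random variables `a l`, `l ≠ 0`, that are independent
except for the relations `conj (a l) = a (-l)`. Nothing is required of `a 0`, which is not used. -/
structure IsGaussianCoefficients (a : (Fin 2 → ℤ) → Ω → ℂ) (P : Measure Ω) : Prop where
  measurable : ∀ l, l ≠ 0 → Measurable (a l)
  hasLaw_re : ∀ l, l ≠ 0 → HasLaw (fun ω => (a l ω).re) (gaussianReal 0 (1 / 2)) P
  hasLaw_im : ∀ l, l ≠ 0 → HasLaw (fun ω => (a l ω).im) (gaussianReal 0 (1 / 2)) P
  indep_re_im : ∀ l, l ≠ 0 → IndepFun (fun ω => (a l ω).re) (fun ω => (a l ω).im) P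
  iIndep : iIndepFun (fun l : halfLattice => a l) P
  conj_eq : ∀ l, l ≠ 0 → ∀ᵐ ω ∂P, conj (a l ω) = a (-l) ω

/-- `Z` is the Leray (microcanonical) measure of the nodal set of `T_n`: the limit in probability
of `(2ε)⁻¹ meas {x : |T_n(x)| < ε}` as `ε → 0+`. -/
def IsLerayMeasure (a : (Fin 2 → ℤ) → Ω → ℂ) (P : Measure Ω) (n : ℕ) (Z : Ω → ℝ) : Prop :=
  TendstoInMeasure P (lerayApprox a n) (𝓝[>] 0) Z

/-- The real Gaussian Hilbert space generated by the coefficients: the closure in `L²(P)` of the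
real linear combinations of the variables `z * a_l + conj z * a_{-l}`, `l ≠ 0`, `z ∈ ℂ`. -/
def gaussianSpace (a : (Fin 2 → ℤ) → Ω → ℂ) (P : Measure Ω) : Submodule ℝ (Lp ℝ 2 P) :=
  (Submodule.span ℝ {ξ : Lp ℝ 2 P | ∃ (l : Fin 2 → ℤ) (z : ℂ), l ≠ 0 ∧
    ∀ᵐ ω ∂P, ((ξ ω : ℝ) : ℂ) = z * a l ω + conj z * a (-l) ω}).topologicalClosure

/-- The `q`-th Wiener chaos: the closure in `L²(P)` of the real linear combinations of the products
`H_{p₁}(ξ₁) ⋯ H_{p_k}(ξ_k)`, where `k ≥ 1`, `p₁ + ⋯ + p_k = q` and `(ξ₁, …, ξ_k)` is a standard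
Gaussian vector with entries in the Gaussian space. `Polynomial.hermite` is the family of
probabilists' Hermite polynomials. -/
def wienerChaos (a : (Fin 2 → ℤ) → Ω → ℂ) (P : Measure Ω) (q : ℕ) : Submodule ℝ (Lp ℝ 2 P) :=
  (Submodule.span ℝ {F : Lp ℝ 2 P | ∃ (k : ℕ) (p : Fin k → ℕ) (ξ : Fin k → Lp ℝ 2 P),
    1 ≤ k ∧ ∑ i, p i = q ∧ (∀ i, ξ i ∈ gaussianSpace a P) ∧
    (∀ i, HasLaw (ξ i) (gaussianReal 0 1) P) ∧ iIndepFun (fun i => (ξ i : Ω → ℝ)) P ∧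
    ∀ᵐ ω ∂P, F ω = ∏ i, Polynomial.aeval (ξ i ω) (Polynomial.hermite (p i))}).topologicalClosure

instance (a : (Fin 2 → ℤ) → Ω → ℂ) (P : Measure Ω) (q : ℕ) :
    CompleteSpace (wienerChaos a P q) :=
  (Submodule.isClosed_topologicalClosure _).completeSpace_coe

/-- The `q`-th chaotic component of `F ∈ L²(P)`: its orthogonal projection onto the `q`-th Wiener
chaos. -/
def chaosComponent (a : (Fin 2 → ℤ) → Ω → ℂ) (P : Measure Ω) (q : ℕ) (F : Lp ℝ 2 P) : Lp ℝ 2 P :=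
  (wienerChaos a P q).starProjection F

end ArithmeticWave

end

noncomputable section

namespace ArithmeticWave

/-! Write `r` for `waveCov n`, `N` for `latticeCount n`, `M_q` for the integral of `r ^ (2q)` and
`c_q` for `centralCoeff q`, the Taylor coefficients of `1 / √(1 - t)`. Two values of the wave at
points differing by `x` form a standard Gaussian vector with correlation `r(x)`, whose density at
the origin is `1 / (2π √(1 - r(x)²))`. The second moment of the approximations therefore tends to
the integral of this density, which is `(2π)⁻¹ ∑ c_q M_q`, and they are Cauchy in `L²`, as soon as
`1 / √(1 - r²)` is integrable.

The Hermite expansion of the Dirac mass at the origin suggests the chaotic component of order `2q`: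
the average over the torus of `H_{2q}(T(x))`, times `H_{2q}(0) / (√(2π) (2q)!)`. For `q ≥ 1` its
variance is `(2π)⁻¹ c_q M_q`. So the series of the second moment displays everything: `q = 0` is the
squared mean, `q = 1` is `1 / (4πN)` because `M_1 = 1 / N`, and the rest is the tail. Completeness
of the chaos decomposition is never needed.

The estimates rest on the decay of the moments. One has `Δr = -4π²n r`, and `|∇r|² ≤ 2π²n (1 - r²)`
by Cauchy-Schwarz and the symmetry of the lattice under a right angle. Integration by parts then
shows that `(2q + 1) M_q` is nonincreasing (`integral_waveCov_pow_succ_le`). Since `∑ c_q / (2q + 1)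
≤ 2`, the tail from `K` is at most a multiple of `(2K + 1) M_K`
(`tsum_centralCoeff_mul_integral_le`). The case `K = 0` is the integrability needed above. The case
`K = 2`, with `M_2 ≤ 3 / N²` (`integral_waveCov_pow_four_le`, a count of common points of two
circles), is the error term.

On the probabilistic side, `integral_deltaApprox_mul_deltaApprox_bounds` controls the second
moments, and `integral_comp_mul_prod_hermiteFun`, a conditional expectation computed by Fourier
transform, identifies the projections in `chaosComponent_eq_lerayComponent`. -/

/-! ### Characters and integration by parts on the torus. -/

instance : IsProbabilityMeasure (volume : Measure (AddCircle (1 : ℝ))) :=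
  ⟨by rw [AddCircle.measure_univ]; simp⟩

theorem continuous_mFourier (l : Fin 2 → ℤ) :
    Continuous fun x : Torus => UnitAddTorus.mFourier l x := (UnitAddTorus.mFourier l).continuous

theorem norm_mFourier_apply (l : Fin 2 → ℤ) (x : Torus) : ‖UnitAddTorus.mFourier l x‖ = 1 := by
  simp only [UnitAddTorus.mFourier, fourier_apply, ContinuousMap.coe_mk, norm_prod, Circle.norm_coe,
    Finset.prod_const_one]

theorem mFourier_add_apply (l : Fin 2 → ℤ) (x y : Torus) :
    UnitAddTorus.mFourier l (x + y) = UnitAddTorus.mFourier l x * UnitAddTorus.mFourier l y := by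
  simp only [UnitAddTorus.mFourier, fourier_apply, smul_add, AddCircle.toCircle_add, Pi.add_apply,
    ContinuousMap.coe_mk, Circle.coe_mul, Finset.prod_mul_distrib]

theorem mFourier_neg_apply (l : Fin 2 → ℤ) (x : Torus) :
    UnitAddTorus.mFourier l (-x) = conj (UnitAddTorus.mFourier l x) := by
  simp only [UnitAddTorus.mFourier, fourier_apply, smul_neg, AddCircle.toCircle_neg, Pi.neg_apply,
    ContinuousMap.coe_mk, Circle.coe_inv_eq_conj, map_prod]

theorem mFourier_re_sq_add_im_sq (l : Fin 2 → ℤ) (x : Torus) :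
    (UnitAddTorus.mFourier l x).re ^ 2 + (UnitAddTorus.mFourier l x).im ^ 2 = 1 := by
  have h := Complex.normSq_eq_norm_sq (UnitAddTorus.mFourier l x)
  rw [norm_mFourier_apply, Complex.normSq_apply] at h
  nlinarith

/-- The translation of the torus by `t` in the direction of the `i`-th coordinate. -/
def coordShift (i : Fin 2) (t : ℝ) : Torus := fun j => ((Pi.single i t : Fin 2 → ℝ) j : ℝ)

theorem mFourier_coordShift (l : Fin 2 → ℤ) (i : Fin 2) (t : ℝ) :
    UnitAddTorus.mFourier l (coordShift i t) = Complex.exp (2 * Real.pi * Complex.I * l i * t) := by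
  have h : ∀ j, fourier (l j) (coordShift i t j) =
      if j = i then Complex.exp (2 * Real.pi * Complex.I * l i * t) else 1 := by
    intro j
    rw [coordShift, fourier_coe_apply]
    by_cases hj : j = i
    · subst hj; simp
    · simp [hj]
  simp only [UnitAddTorus.mFourier, ContinuousMap.coe_mk, h]
  simp

theorem hasDerivAt_mFourier_coordShift (l : Fin 2 → ℤ) (i : Fin 2) (x : Torus) (t : ℝ) :
    HasDerivAt (fun t : ℝ => UnitAddTorus.mFourier l (x + coordShift i t))
      (2 * Real.pi * Complex.I * l i * UnitAddTorus.mFourier l (x + coordShift i t)) t := by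
  simp only [mFourier_add_apply, mFourier_coordShift]
  have h1 : HasDerivAt (fun t : ℝ => 2 * Real.pi * Complex.I * l i * (t : ℂ))
      (2 * Real.pi * Complex.I * l i * 1) t := Complex.ofRealCLM.hasDerivAt.const_mul _
  have h2 := (h1.cexp).const_mul (UnitAddTorus.mFourier l x)
  exact h2.congr_deriv (by ring)

theorem hasDerivAt_re_mFourier_coordShift (l : Fin 2 → ℤ) (i : Fin 2) (x : Torus) (t : ℝ) :
    HasDerivAt (fun t : ℝ => (UnitAddTorus.mFourier l (x + coordShift i t)).re)
      (-(2 * Real.pi * l i * (UnitAddTorus.mFourier l (x + coordShift i t)).im)) t := by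
  refine (Complex.reCLM.hasFDerivAt.comp_hasDerivAt t
    (hasDerivAt_mFourier_coordShift l i x t)).congr_deriv ?_
  simp [Complex.mul_re]

theorem hasDerivAt_im_mFourier_coordShift (l : Fin 2 → ℤ) (i : Fin 2) (x : Torus) (t : ℝ) :
    HasDerivAt (fun t : ℝ => (UnitAddTorus.mFourier l (x + coordShift i t)).im)
      (2 * Real.pi * l i * (UnitAddTorus.mFourier l (x + coordShift i t)).re) t := by
  refine (Complex.imCLM.hasFDerivAt.comp_hasDerivAt t
    (hasDerivAt_mFourier_coordShift l i x t)).congr_deriv ?_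
  simp [Complex.mul_im]

theorem integrable_of_continuous_torus {E : Type*} [NormedAddCommGroup E] {F : Torus → E}
    (hF : Continuous F) : Integrable F := by
  rw [← integrableOn_univ]
  exact hF.continuousOn.integrableOn_compact isCompact_univ

/-- By translation invariance the integral of `F(x + t e_i)` does not depend on `t`, so its
derivative vanishes. Applied to a product, this is integration by parts without boundary term. -/
theorem integral_coordShift_deriv_eq_zero (i : Fin 2) {F F' : Torus → ℝ} (hF : Continuous F)
    (hF' : Continuous F')
    (h : ∀ x t, HasDerivAt (fun t : ℝ => F (x + coordShift i t)) (F' (x + coordShift i t)) t) :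
    ∫ x, F' x = 0 := by
  obtain ⟨C, hC⟩ := isCompact_univ.exists_bound_of_continuousOn (f := F') hF'.continuousOn
  have h0 : coordShift i 0 = 0 := by
    funext j; simp [coordShift]
  have key := hasDerivAt_integral_of_dominated_loc_of_deriv_le
    (μ := (volume : Measure Torus)) (F := fun t x => F (x + coordShift i t))
    (F' := fun t x => F' (x + coordShift i t)) (x₀ := 0) (s := Set.univ) (bound := fun _ => C)
    univ_mem
    (Eventually.of_forall fun t => (hF.comp (continuous_add_const _)).aestronglyMeasurable)
    (integrable_of_continuous_torus (hF.comp (continuous_add_const _)))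
    (hF'.comp (continuous_add_const _)).aestronglyMeasurable
    (Eventually.of_forall fun x t _ => hC _ (Set.mem_univ _))
    (integrable_const _) (Eventually.of_forall fun x t _ => h x t)
  have h2 := key.2
  simp only [integral_add_right_eq_self, h0, add_zero] at h2
  exact h2.unique (hasDerivAt_const _ _)

/-- Along a coordinate with `l i ≠ 0`, the real and imaginary parts of the character are, up to a
nonzero factor, derivatives of each other. -/
theorem integral_mFourier_eq_zero {l : Fin 2 → ℤ} (hl : l ≠ 0) :
    ∫ x : Torus, UnitAddTorus.mFourier l x = 0 := by
  obtain ⟨i, hi⟩ := Function.ne_iff.mp hl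
  have hli : (l i : ℝ) ≠ 0 := by exact_mod_cast hi
  have hc := continuous_mFourier l
  have hre : ∫ x : Torus, (UnitAddTorus.mFourier l x).re = 0 := by
    have := integral_coordShift_deriv_eq_zero i
      (F := fun x => (UnitAddTorus.mFourier l x).im)
      (F' := fun x => 2 * Real.pi * l i * (UnitAddTorus.mFourier l x).re)
      (by fun_prop) (by fun_prop) (hasDerivAt_im_mFourier_coordShift l i)
    rw [integral_const_mul] at this
    simpa [Real.pi_ne_zero, hli] using this
  have him : ∫ x : Torus, (UnitAddTorus.mFourier l x).im = 0 := by
    have := integral_coordShift_deriv_eq_zero i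
      (F := fun x => (UnitAddTorus.mFourier l x).re)
      (F' := fun x => -(2 * Real.pi * l i * (UnitAddTorus.mFourier l x).im))
      (by fun_prop) (by fun_prop) (hasDerivAt_re_mFourier_coordShift l i)
    rw [integral_neg, integral_const_mul] at this
    simpa [Real.pi_ne_zero, hli] using this
  have hint := integrable_of_continuous_torus hc
  apply Complex.ext
  · rw [← RCLike.re_eq_complex_re, ← integral_re hint]; simpa using hre
  · rw [← RCLike.im_eq_complex_im, ← integral_im hint]; simpa using him

theorem integral_mFourier (l : Fin 2 → ℤ) :
    ∫ x : Torus, UnitAddTorus.mFourier l x = if l = 0 then 1 else 0 := by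
  split_ifs with h
  · simp [h, UnitAddTorus.mFourier_zero]
  · exact integral_mFourier_eq_zero h

/-! ### The lattice points on a circle -/

theorem neg_mem_latticePoints {n : ℕ} {l : Fin 2 → ℤ} (h : l ∈ latticePoints n) :
    -l ∈ latticePoints n := by
  rw [mem_latticePoints] at *; simpa using h

theorem ne_zero_of_mem_latticePoints {n : ℕ} (hn : 0 < n) {l : Fin 2 → ℤ}
    (h : l ∈ latticePoints n) : l ≠ 0 := by
  rintro rfl
  rw [mem_latticePoints] at h
  simp at h
  omega

theorem sum_latticePoints_neg {M : Type*} [AddCommMonoid M] (n : ℕ) (f : (Fin 2 → ℤ) → M) :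
    ∑ l ∈ latticePoints n, f (-l) = ∑ l ∈ latticePoints n, f l :=
  Finset.sum_bij' (fun l _ => -l) (fun l _ => -l) (fun _ h => neg_mem_latticePoints h)
    (fun _ h => neg_mem_latticePoints h) (by simp) (by simp) (by simp)

/-- The rotation of the lattice by a right angle. -/
def rotateLattice (l : Fin 2 → ℤ) : Fin 2 → ℤ := ![-l 1, l 0]

theorem sum_latticePoints_rotate {M : Type*} [AddCommMonoid M] (n : ℕ) (f : (Fin 2 → ℤ) → M) :
    ∑ l ∈ latticePoints n, f (rotateLattice l) = ∑ l ∈ latticePoints n, f l := by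
  refine Finset.sum_bij' (fun l _ => rotateLattice l) (fun l _ => -rotateLattice l) ?_ ?_ ?_ ?_ ?_
  · intro l h; rw [mem_latticePoints] at *; simp [rotateLattice, ← h]; ring
  · intro l h; rw [mem_latticePoints] at *; simp [rotateLattice, ← h]; ring
  · intro l _; funext i; fin_cases i <;> simp [rotateLattice]
  · intro l _; funext i; fin_cases i <;> simp [rotateLattice]
  · simp

theorem latticeCount_pos {n : ℕ} (hn : n ∈ sumsOfTwoSquares) : 0 < latticeCount n := by
  obtain ⟨a, b, h⟩ := hn
  exact Finset.card_pos.mpr ⟨![a, b], by rw [mem_latticePoints]; simp [h]⟩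

/-- The right-angle rotation exchanges the two coordinate sums, and together they give `n N`. With
`sum_coord_mul_coord` this is the isotropy of the lattice points: their second moment matrix is
scalar. -/
theorem sum_sq_coord (n : ℕ) (i : Fin 2) :
    ∑ l ∈ latticePoints n, (l i : ℝ) ^ 2 = n / 2 * latticeCount n := by
  have h1 : ∑ l ∈ latticePoints n, (l 0 : ℝ) ^ 2 = ∑ l ∈ latticePoints n, (l 1 : ℝ) ^ 2 := by
    rw [← sum_latticePoints_rotate]
    simp [rotateLattice]
  have h2 : ∑ l ∈ latticePoints n, ((l 0 : ℝ) ^ 2 + (l 1 : ℝ) ^ 2) = n * latticeCount n := by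
    rw [Finset.sum_congr rfl (g := fun _ => (n : ℝ))]
    · simp [latticeCount, mul_comm]
    · intro l hl
      rw [mem_latticePoints] at hl
      exact_mod_cast hl
  rw [Finset.sum_add_distrib] at h2
  fin_cases i <;> simp <;> linarith

theorem sum_coord_mul_coord (n : ℕ) : ∑ l ∈ latticePoints n, (l 0 : ℝ) * l 1 = 0 := by
  have h := sum_latticePoints_rotate n (fun l => (l 0 : ℝ) * l 1)
  simp only [rotateLattice, Matrix.cons_val_zero, Matrix.cons_val_one, Int.cast_neg, neg_mul,
    Finset.sum_neg_distrib] at h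
  have h2 : ∑ l ∈ latticePoints n, (l 1 : ℝ) * l 0 = ∑ l ∈ latticePoints n, (l 0 : ℝ) * l 1 :=
    Finset.sum_congr rfl fun _ _ => mul_comm _ _
  linarith

/-! ### The covariance function and its gradient -/

@[fun_prop]
theorem continuous_waveCov (n : ℕ) : Continuous (waveCov n) := by
  unfold waveCov
  have := continuous_mFourier
  fun_prop

/-- The `i`-th partial derivative of `waveCov`. -/
def waveCovGrad (n : ℕ) (i : Fin 2) (x : Torus) : ℝ :=
  (latticeCount n : ℝ)⁻¹ *
    ∑ l ∈ latticePoints n, -(2 * Real.pi * l i * (UnitAddTorus.mFourier l x).im)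

/-- The `i`-th second partial derivative of `waveCov`. -/
def waveCovHess (n : ℕ) (i : Fin 2) (x : Torus) : ℝ :=
  (latticeCount n : ℝ)⁻¹ *
    ∑ l ∈ latticePoints n, -(2 * Real.pi * l i * (2 * Real.pi * l i * (UnitAddTorus.mFourier l x).re))

@[fun_prop]
theorem continuous_waveCovGrad (n : ℕ) (i : Fin 2) : Continuous (waveCovGrad n i) := by
  unfold waveCovGrad
  have := continuous_mFourier
  fun_prop

@[fun_prop]
theorem continuous_waveCovHess (n : ℕ) (i : Fin 2) : Continuous (waveCovHess n i) := by
  unfold waveCovHess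
  have := continuous_mFourier
  fun_prop

theorem hasDerivAt_waveCov_coordShift (n : ℕ) (i : Fin 2) (x : Torus) (t : ℝ) :
    HasDerivAt (fun t => waveCov n (x + coordShift i t)) (waveCovGrad n i (x + coordShift i t)) t :=
  (HasDerivAt.fun_sum (u := latticePoints n) fun l _ =>
    hasDerivAt_re_mFourier_coordShift l i x t).const_mul _

theorem hasDerivAt_waveCovGrad_coordShift (n : ℕ) (i : Fin 2) (x : Torus) (t : ℝ) :
    HasDerivAt (fun t => waveCovGrad n i (x + coordShift i t))
      (waveCovHess n i (x + coordShift i t)) t :=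
  (HasDerivAt.fun_sum fun l _ =>
    ((hasDerivAt_im_mFourier_coordShift l i x t).const_mul (2 * Real.pi * l i)).neg).const_mul _

/-- The Laplace eigenvalue equation: all frequencies have the same norm. -/
theorem waveCovHess_add (n : ℕ) (x : Torus) :
    waveCovHess n 0 x + waveCovHess n 1 x = -(4 * Real.pi ^ 2 * n) * waveCov n x := by
  unfold waveCovHess waveCov
  simp only [Finset.mul_sum, ← Finset.sum_add_distrib]
  refine Finset.sum_congr rfl fun l hl => ?_
  rw [mem_latticePoints] at hl
  have hl' : (l 0 : ℝ) ^ 2 + (l 1 : ℝ) ^ 2 = n := by exact_mod_cast hl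
  rw [← hl']
  ring

theorem waveCov_sq_le_mean (n : ℕ) (hn : n ∈ sumsOfTwoSquares) (x : Torus) :
    waveCov n x ^ 2 ≤ (latticeCount n : ℝ)⁻¹ *
      ∑ l ∈ latticePoints n, (UnitAddTorus.mFourier l x).re ^ 2 := by
  have hN : (0 : ℝ) < latticeCount n := by exact_mod_cast latticeCount_pos hn
  have h := sq_sum_le_card_mul_sum_sq (s := latticePoints n)
    (f := fun l => (UnitAddTorus.mFourier l x).re)
  rw [← latticeCount] at h
  unfold waveCov
  rw [mul_pow]
  calc _ ≤ ((latticeCount n : ℝ)⁻¹) ^ 2 * ((latticeCount n : ℝ) *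
        ∑ l ∈ latticePoints n, (UnitAddTorus.mFourier l x).re ^ 2) := by gcongr
    _ = _ := by field_simp

/-- Cauchy-Schwarz bounds `r²` by the mean of the squared cosines; the squared sines make up the
rest of one. -/
theorem mean_im_sq_le (n : ℕ) (hn : n ∈ sumsOfTwoSquares) (x : Torus) :
    (latticeCount n : ℝ)⁻¹ * ∑ l ∈ latticePoints n, (UnitAddTorus.mFourier l x).im ^ 2
      ≤ 1 - waveCov n x ^ 2 := by
  have hN : (0 : ℝ) < latticeCount n := by exact_mod_cast latticeCount_pos hn
  have h := waveCov_sq_le_mean n hn x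
  have h2 : (latticeCount n : ℝ)⁻¹ * ∑ l ∈ latticePoints n, (UnitAddTorus.mFourier l x).re ^ 2
      + (latticeCount n : ℝ)⁻¹ * ∑ l ∈ latticePoints n, (UnitAddTorus.mFourier l x).im ^ 2 = 1 := by
    rw [← mul_add, ← Finset.sum_add_distrib]
    simp only [mFourier_re_sq_add_im_sq]
    rw [Finset.sum_const, nsmul_eq_mul, mul_one]
    exact inv_mul_cancel₀ hN.ne'
  linarith

theorem waveCov_sq_le_one (n : ℕ) (hn : n ∈ sumsOfTwoSquares) (x : Torus) :
    waveCov n x ^ 2 ≤ 1 := by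
  have h := mean_im_sq_le n hn x
  have : 0 ≤ (latticeCount n : ℝ)⁻¹ *
    ∑ l ∈ latticePoints n, (UnitAddTorus.mFourier l x).im ^ 2 := by positivity
  linarith

/-- The gradient of the covariance function is small where its modulus is close to one. -/
theorem waveCovGrad_sq_add_sq_le (n : ℕ) (hn : n ∈ sumsOfTwoSquares) (x : Torus) :
    waveCovGrad n 0 x ^ 2 + waveCovGrad n 1 x ^ 2
      ≤ 2 * Real.pi ^ 2 * n * (1 - waveCov n x ^ 2) := by
  have hN : (0 : ℝ) < latticeCount n := by exact_mod_cast latticeCount_pos hn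
  set g0 := waveCovGrad n 0 x with hg0
  set g1 := waveCovGrad n 1 x with hg1
  set G := g0 ^ 2 + g1 ^ 2 with hG
  set S := (latticeCount n : ℝ)⁻¹ * ∑ l ∈ latticePoints n, (UnitAddTorus.mFourier l x).im ^ 2
    with hS
  have hSle : S ≤ 1 - waveCov n x ^ 2 := mean_im_sq_le n hn x
  have hG0 : 0 ≤ G := by positivity
  -- The squared length is the gradient paired with itself. This puts it in the form of one sum over
  -- the lattice points, to which Cauchy-Schwarz applies without loss from treating the coordinates
  -- separately.
  have e1 : G = (latticeCount n : ℝ)⁻¹ * (-(2 * Real.pi)) *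
      ∑ l ∈ latticePoints n, (g0 * l 0 + g1 * l 1) * (UnitAddTorus.mFourier l x).im := by
    have e : G = g0 * waveCovGrad n 0 x + g1 * waveCovGrad n 1 x := by
      rw [hG, pow_two, pow_two]
    rw [e]
    unfold waveCovGrad
    simp only [Finset.mul_sum, ← Finset.sum_add_distrib]
    refine Finset.sum_congr rfl fun l _ => ?_
    ring
  have e2 : ∑ l ∈ latticePoints n, (g0 * l 0 + g1 * l 1) ^ 2 = n / 2 * latticeCount n * G := by
    have : ∀ l : Fin 2 → ℤ, (g0 * l 0 + g1 * l 1) ^ 2 =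
        g0 ^ 2 * (l 0 : ℝ) ^ 2 + 2 * g0 * g1 * ((l 0 : ℝ) * l 1) + g1 ^ 2 * (l 1 : ℝ) ^ 2 := by
      intro l; ring
    simp only [this, Finset.sum_add_distrib, ← Finset.mul_sum, sum_sq_coord, sum_coord_mul_coord]
    ring
  have cs := Finset.sum_mul_sq_le_sq_mul_sq (latticePoints n)
    (fun l => g0 * l 0 + g1 * l 1) (fun l => (UnitAddTorus.mFourier l x).im)
  rw [e2] at cs
  have e3 : ∑ l ∈ latticePoints n, (UnitAddTorus.mFourier l x).im ^ 2 = latticeCount n * S := by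
    rw [hS]; field_simp
  rw [e3] at cs
  -- `e1` opens the square on the left and is folded back on the right; the result is quadratic in
  -- `G` against linear, and `e5` divides by `G`.
  have e4 : G ^ 2 ≤ 2 * Real.pi ^ 2 * n * S * G := by
    rw [e1, mul_pow, ← e1]
    calc _ ≤ ((latticeCount n : ℝ)⁻¹ * (-(2 * Real.pi))) ^ 2 *
          (n / 2 * latticeCount n * G * (latticeCount n * S)) := by gcongr
      _ = _ := by field_simp
  have e5 : G ≤ 2 * Real.pi ^ 2 * n * S := by
    rcases hG0.eq_or_lt with h | h
    · rw [← h]; positivity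
    · nlinarith
  calc G ≤ _ := e5
    _ ≤ _ := by gcongr

/-! ### Moments of the covariance function -/

theorem integrable_waveCov_pow (n k : ℕ) : Integrable fun x => waveCov n x ^ k :=
  integrable_of_continuous_torus (by fun_prop)

/-- The moments of the covariance function decay: integrate `r ^ (2q+1) Δr` by parts. -/
theorem integral_waveCov_pow_succ_le (n : ℕ) (hn : n ∈ sumsOfTwoSquares) (hn0 : 0 < n) (q : ℕ) :
    (2 * q + 3 : ℝ) * ∫ x, waveCov n x ^ (2 * (q + 1))
      ≤ (2 * q + 1) * ∫ x, waveCov n x ^ (2 * q) := by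
  have hn' : (0 : ℝ) < n := by exact_mod_cast hn0
  have parts : ∀ i : Fin 2, ∫ x, ((2 * q + 1 : ℕ) * waveCov n x ^ (2 * q) * waveCovGrad n i x
      * waveCovGrad n i x + waveCov n x ^ (2 * q + 1) * waveCovHess n i x) = 0 := by
    intro i
    refine integral_coordShift_deriv_eq_zero i
      (F := fun x => waveCov n x ^ (2 * q + 1) * waveCovGrad n i x) (by fun_prop) (by fun_prop) ?_
    intro x t
    exact ((hasDerivAt_waveCov_coordShift n i x t).pow (2 * q + 1)).mul
      (hasDerivAt_waveCovGrad_coordShift n i x t)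
  have hi : ∀ i : Fin 2, Integrable fun x => ((2 * q + 1 : ℕ) * waveCov n x ^ (2 * q) *
      waveCovGrad n i x * waveCovGrad n i x + waveCov n x ^ (2 * q + 1) * waveCovHess n i x) :=
    fun i => integrable_of_continuous_torus (by fun_prop)
  have hsum : 0 = ∫ x, ((2 * q + 1 : ℝ) * waveCov n x ^ (2 * q) *
      (waveCovGrad n 0 x ^ 2 + waveCovGrad n 1 x ^ 2)
      - 4 * Real.pi ^ 2 * n * waveCov n x ^ (2 * (q + 1))) := by
    have h := integral_add (hi 0) (hi 1)
    rw [parts 0, parts 1, add_zero] at h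
    rw [← h]
    refine integral_congr_ae (Eventually.of_forall fun x => ?_)
    have := waveCovHess_add n x
    have e : waveCov n x ^ (2 * q + 1) * waveCovHess n 0 x
        + waveCov n x ^ (2 * q + 1) * waveCovHess n 1 x
        = -(4 * Real.pi ^ 2 * n) * waveCov n x ^ (2 * (q + 1)) := by
      rw [← mul_add, this]; ring
    push_cast
    linear_combination e
  -- The gradient bound enters here. The factor `2q + 3` is `2q + 1`, from the term `-r²` of that
  -- bound, plus `2`, from the eigenvalue `4π²n` in units of `2π²n`.
  have hle : 0 ≤ ∫ x, ((2 * q + 1 : ℝ) * (2 * Real.pi ^ 2 * n) * waveCov n x ^ (2 * q)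
      - (2 * Real.pi ^ 2 * n) * (2 * q + 3) * waveCov n x ^ (2 * (q + 1))) := by
    rw [hsum]
    refine integral_mono (integrable_of_continuous_torus (by fun_prop))
      (integrable_of_continuous_torus (by fun_prop)) fun x => ?_
    have h1 := waveCovGrad_sq_add_sq_le n hn x
    have h2 : 0 ≤ (2 * q + 1 : ℝ) * waveCov n x ^ (2 * q) :=
      mul_nonneg (by positivity) ((even_two_mul q).pow_nonneg _)
    have h3 := mul_le_mul_of_nonneg_left h1 h2
    have e : waveCov n x ^ (2 * (q + 1)) = waveCov n x ^ (2 * q) * waveCov n x ^ 2 := by ring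
    simp only [e]
    nlinarith
  rw [integral_sub ((integrable_waveCov_pow n _).const_mul _)
    ((integrable_waveCov_pow n _).const_mul _), integral_const_mul, integral_const_mul] at hle
  have hp : 0 < 2 * Real.pi ^ 2 * n := by positivity
  by_contra! hcon
  nlinarith [mul_lt_mul_of_pos_left hcon hp]

theorem integral_waveCov_pow_nonneg (n q : ℕ) : 0 ≤ ∫ x, waveCov n x ^ (2 * q) :=
  integral_nonneg fun _ => (even_two_mul q).pow_nonneg _

/-- Iterates the previous inequality: the quantity `(2q + 1) M_q` is nonincreasing in `q`. -/
theorem integral_waveCov_pow_le (n : ℕ) (hn : n ∈ sumsOfTwoSquares) (hn0 : 0 < n) (K j : ℕ) :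
    (2 * (K + j : ℕ) + 1 : ℝ) * ∫ x, waveCov n x ^ (2 * (K + j))
      ≤ (2 * K + 1) * ∫ x, waveCov n x ^ (2 * K) := by
  induction j with
  | zero => simp
  | succ j ih =>
    have := integral_waveCov_pow_succ_le n hn hn0 (K + j)
    rw [← add_assoc]
    push_cast at *
    linarith

/-- The measure of the exceptional set is at most every moment `M_q`, and these tend to zero since
`(2q + 1) M_q ≤ M_0 = 1`. -/
theorem ae_waveCov_sq_lt_one (n : ℕ) (hn : n ∈ sumsOfTwoSquares) (hn0 : 0 < n) :
    ∀ᵐ x : Torus, waveCov n x ^ 2 < 1 := by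
  have hm : MeasurableSet {x : Torus | ¬ waveCov n x ^ 2 < 1} :=
    (measurableSet_lt ((continuous_waveCov n).pow 2).measurable measurable_const).compl
  have hb : ∀ q : ℕ, (volume : Measure Torus).real {x | ¬ waveCov n x ^ 2 < 1}
      ≤ 1 / ((q : ℝ) + 1) := by
    intro q
    have h1 := integral_waveCov_pow_le n hn hn0 0 q
    simp only [zero_add, mul_zero, pow_zero, integral_const, probReal_univ, smul_eq_mul, mul_one,
      Nat.cast_zero] at h1
    have h2 : (volume : Measure Torus).real {x | ¬ waveCov n x ^ 2 < 1}
        ≤ ∫ x, waveCov n x ^ (2 * q) := by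
      rw [← integral_indicator_one hm]
      refine integral_mono ((integrable_const (1 : ℝ)).indicator hm)
        (integrable_waveCov_pow n _) fun x => ?_
      by_cases hx : x ∈ {x : Torus | ¬ waveCov n x ^ 2 < 1}
      · rw [Set.indicator_of_mem hx, pow_mul]
        exact one_le_pow₀ (not_lt.mp hx)
      · rw [Set.indicator_of_notMem hx]
        exact (even_two_mul q).pow_nonneg _
    rw [le_div_iff₀ (by positivity)]
    have h3 := integral_waveCov_pow_nonneg n q
    nlinarith
  rw [ae_iff]
  have h0 : (volume : Measure Torus).real {x | ¬ waveCov n x ^ 2 < 1} ≤ 0 :=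
    ge_of_tendsto' tendsto_one_div_add_atTop_nhds_zero_nat hb
  have := le_antisymm h0 measureReal_nonneg
  rwa [measureReal_eq_zero_iff] at this

/-! ### Second and fourth moments by counting lattice points. -/

/-- The symmetry `l ↦ -l` cancels the imaginary parts. In this form powers expand into characters,
whose integrals count zero sums of lattice points. -/
theorem waveCov_eq_complex (n : ℕ) (x : Torus) :
    (waveCov n x : ℂ) =
      (latticeCount n : ℂ)⁻¹ * ∑ l ∈ latticePoints n, UnitAddTorus.mFourier l x := by
  have him : (∑ l ∈ latticePoints n, UnitAddTorus.mFourier l x).im = 0 := by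
    have h := sum_latticePoints_neg n fun l => UnitAddTorus.mFourier l x
    simp only [UnitAddTorus.mFourier_neg, ← map_sum] at h
    exact Complex.conj_eq_iff_im.mp h
  unfold waveCov
  push_cast
  congr 1
  apply Complex.ext
  · rw [← Complex.ofReal_sum, Complex.ofReal_re, Complex.re_sum]
  · rw [him, ← Complex.ofReal_sum, Complex.ofReal_im]

/-- Among the `N²` pairs `(l, m)` only the `N` pairs with `m = -l` contribute. -/
theorem integral_waveCov_sq (n : ℕ) (hn : n ∈ sumsOfTwoSquares) :
    ∫ x, waveCov n x ^ 2 = (latticeCount n : ℝ)⁻¹ := by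
  have hN : (latticeCount n : ℂ) ≠ 0 := by exact_mod_cast (latticeCount_pos hn).ne'
  have h : ((∫ x, waveCov n x ^ 2 : ℝ) : ℂ) = ((latticeCount n : ℝ)⁻¹ : ℝ) := by
    rw [← integral_complex_ofReal]
    have e : ∀ x, ((waveCov n x ^ 2 : ℝ) : ℂ) = (latticeCount n : ℂ)⁻¹ ^ 2 *
        ∑ l ∈ latticePoints n, ∑ m ∈ latticePoints n, UnitAddTorus.mFourier (l + m) x := by
      intro x
      push_cast
      rw [waveCov_eq_complex, mul_pow, pow_two (∑ l ∈ latticePoints n, _), Finset.sum_mul_sum]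
      simp only [UnitAddTorus.mFourier_add]
    have hi : ∀ l, Integrable fun x : Torus => UnitAddTorus.mFourier l x := fun l =>
      integrable_of_continuous_torus (continuous_mFourier l)
    simp only [e]
    rw [integral_const_mul, integral_finsetSum _ fun l _ => integrable_finsetSum _ fun m _ => hi _]
    have e2 : ∀ l ∈ latticePoints n,
        ∫ x : Torus, ∑ m ∈ latticePoints n, UnitAddTorus.mFourier (l + m) x = 1 := by
      intro l hl
      rw [integral_finsetSum _ fun m _ => hi _]
      simp only [integral_mFourier, add_eq_zero_iff_neg_eq]
      rw [Finset.sum_ite_eq, if_pos (neg_mem_latticePoints hl)]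
    rw [Finset.sum_congr rfl e2]
    simp only [Finset.sum_const, nsmul_eq_mul, mul_one]
    rw [← latticeCount]
    push_cast
    field_simp
  exact_mod_cast h

/-- Two distinct circles of the same radius have at most two common lattice points. -/
theorem card_filter_sub_mem_latticePoints_le (n : ℕ) {v : Fin 2 → ℤ} (hv : v ≠ 0) :
    ((latticePoints n).filter fun c => v - c ∈ latticePoints n).card ≤ 2 := by
  rcases Finset.eq_empty_or_nonempty ((latticePoints n).filter fun c => v - c ∈ latticePoints n)
    with h | ⟨b, hb⟩
  · simp [h]
  refine (Finset.card_le_card (t := {b, v - b}) fun c hc => ?_).trans Finset.card_le_two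
  simp only [Finset.mem_filter, mem_latticePoints, Pi.sub_apply] at hb hc
  obtain ⟨hb1, hb2⟩ := hb
  obtain ⟨hc1, hc2⟩ := hc
  -- Both `b` and `c` satisfy `2⟨v, c⟩ = |v|²`, so their difference is orthogonal to `v`.
  have hdot : v 0 * (c 0 - b 0) + v 1 * (c 1 - b 1) = 0 := by nlinarith
  have hvpos : 0 < v 0 ^ 2 + v 1 ^ 2 := by
    by_contra! hcon
    have h0 : v 0 = 0 := by nlinarith [sq_nonneg (v 0), sq_nonneg (v 1)]
    have h1 : v 1 = 0 := by nlinarith [sq_nonneg (v 0), sq_nonneg (v 1)]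
    exact hv (funext fun i => by fin_cases i <;> simp [h0, h1])
  -- By Lagrange's identity `det(v, c)² + ⟨v, c⟩² = |v|² n`, and the inner products agree, so the
  -- determinants agree up to sign. Equal signs give `c = b`, opposite signs `c = v - b`.
  have hcross : (v 0 * c 1 - v 1 * c 0 - (v 0 * b 1 - v 1 * b 0)) *
      (v 0 * c 1 - v 1 * c 0 + (v 0 * b 1 - v 1 * b 0)) = 0 := by
    have e1 : (v 0 * c 1 - v 1 * c 0) ^ 2 + (v 0 * c 0 + v 1 * c 1) ^ 2 =
      (v 0 * b 1 - v 1 * b 0) ^ 2 + (v 0 * b 0 + v 1 * b 1) ^ 2 := by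
      have : ∀ x y : ℤ, x ^ 2 + y ^ 2 = n →
          (v 0 * y - v 1 * x) ^ 2 + (v 0 * x + v 1 * y) ^ 2 = (v 0 ^ 2 + v 1 ^ 2) * n := by
        intro x y h; rw [← h]; ring
      rw [this _ _ hc1, this _ _ hb1]
    have e2 : v 0 * c 0 + v 1 * c 1 = v 0 * b 0 + v 1 * b 1 := by linarith
    rw [e2] at e1
    linarith
  have hvv : 2 * (v 0 * b 0 + v 1 * b 1) = v 0 ^ 2 + v 1 ^ 2 := by nlinarith
  rw [Finset.mem_insert, Finset.mem_singleton]
  rcases mul_eq_zero.mp hcross with h | h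
  · left
    have h0 : (v 0 ^ 2 + v 1 ^ 2) * (c 0 - b 0) = 0 := by
      linear_combination v 0 * hdot - v 1 * h
    have h1 : (v 0 ^ 2 + v 1 ^ 2) * (c 1 - b 1) = 0 := by
      linear_combination v 1 * hdot + v 0 * h
    have h0' := (mul_eq_zero.mp h0).resolve_left hvpos.ne'
    have h1' := (mul_eq_zero.mp h1).resolve_left hvpos.ne'
    funext i
    fin_cases i <;> simp <;> linarith
  · right
    have h0 : (v 0 ^ 2 + v 1 ^ 2) * (c 0 - (v 0 - b 0)) = 0 := by
      linear_combination v 0 * hdot - v 1 * h + v 0 * hvv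
    have h1 : (v 0 ^ 2 + v 1 ^ 2) * (c 1 - (v 1 - b 1)) = 0 := by
      linear_combination v 1 * hdot + v 0 * h + v 1 * hvv
    have h0' := (mul_eq_zero.mp h0).resolve_left hvpos.ne'
    have h1' := (mul_eq_zero.mp h1).resolve_left hvpos.ne'
    funext i
    fin_cases i <;> simp <;> linarith

/-- The integral is `N⁻⁴` times the number of quadruples with zero sum. Given `a` and `b`, there are
at most two choices of `c` if `a + b ≠ 0` and at most `N` if `b = -a`, which makes at most `N (2N +
N)` quadruples. -/
theorem integral_waveCov_pow_four_le (n : ℕ) (hn : n ∈ sumsOfTwoSquares) :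
    ∫ x, waveCov n x ^ 4 ≤ 3 / (latticeCount n : ℝ) ^ 2 := by
  have hN0 : (0 : ℝ) < latticeCount n := by exact_mod_cast latticeCount_pos hn
  have hN : (latticeCount n : ℂ) ≠ 0 := by exact_mod_cast (latticeCount_pos hn).ne'
  set Λ := latticePoints n with hΛ
  have h : ((∫ x, waveCov n x ^ 4 : ℝ) : ℂ) =
      (((latticeCount n : ℝ)⁻¹ ^ 4 * ∑ a ∈ Λ, ∑ b ∈ Λ, ∑ c ∈ Λ, ∑ d ∈ Λ,
        if a + b + c + d = 0 then 1 else 0 : ℝ) : ℂ) := by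
    rw [← integral_complex_ofReal]
    have e : ∀ x, ((waveCov n x ^ 4 : ℝ) : ℂ) = (latticeCount n : ℂ)⁻¹ ^ 4 *
        ∑ a ∈ Λ, ∑ b ∈ Λ, ∑ c ∈ Λ, ∑ d ∈ Λ, UnitAddTorus.mFourier (a + b + c + d) x := by
      intro x
      push_cast
      rw [waveCov_eq_complex, mul_pow]
      congr 1
      simp only [UnitAddTorus.mFourier_add, ← Finset.mul_sum, ← Finset.sum_mul]
      ring
    have hi : ∀ l, Integrable fun x : Torus => UnitAddTorus.mFourier l x := fun l =>
      integrable_of_continuous_torus (continuous_mFourier l)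
    simp only [e]
    rw [integral_const_mul, integral_finsetSum _ fun a _ => integrable_finsetSum _ fun b _ =>
      integrable_finsetSum _ fun c _ => integrable_finsetSum _ fun d _ => hi _]
    push_cast
    congr 1
    refine Finset.sum_congr rfl fun a _ => ?_
    rw [integral_finsetSum _ fun b _ =>
      integrable_finsetSum _ fun c _ => integrable_finsetSum _ fun d _ => hi _]
    refine Finset.sum_congr rfl fun b _ => ?_
    rw [integral_finsetSum _ fun c _ => integrable_finsetSum _ fun d _ => hi _]
    refine Finset.sum_congr rfl fun c _ => ?_
    rw [integral_finsetSum _ fun d _ => hi _]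
    refine Finset.sum_congr rfl fun d _ => ?_
    rw [integral_mFourier]
    split_ifs <;> simp
  have h' := Complex.ofReal_injective h
  rw [h']
  have inner : ∀ v : Fin 2 → ℤ, ∑ c ∈ Λ, ∑ d ∈ Λ, (if v + c + d = 0 then 1 else 0 : ℝ)
      ≤ 2 + if v = 0 then (latticeCount n : ℝ) else 0 := by
    intro v
    have e : ∀ c ∈ Λ, ∑ d ∈ Λ, (if v + c + d = 0 then 1 else 0 : ℝ) =
        if -v - c ∈ Λ then 1 else 0 := by
      intro c _
      have : ∀ d, v + c + d = 0 ↔ -v - c = d := by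
        intro d
        rw [add_eq_zero_iff_neg_eq, neg_add, ← sub_eq_add_neg]
      simp only [this, Finset.sum_ite_eq]
    rw [Finset.sum_congr rfl e, Finset.sum_boole]
    by_cases hv : v = 0
    · rw [if_pos hv]
      have h1 : (Λ.filter fun c => -v - c ∈ Λ).card ≤ latticeCount n := Finset.card_filter_le _ _
      have h2 : ((Λ.filter fun c => -v - c ∈ Λ).card : ℝ) ≤ latticeCount n := by exact_mod_cast h1
      linarith
    · rw [if_neg hv, add_zero]
      exact_mod_cast card_filter_sub_mem_latticePoints_le n (neg_ne_zero.mpr hv)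
  have total : ∑ a ∈ Λ, ∑ b ∈ Λ, ∑ c ∈ Λ, ∑ d ∈ Λ, (if a + b + c + d = 0 then 1 else 0 : ℝ)
      ≤ 3 * (latticeCount n : ℝ) ^ 2 := by
    calc _ ≤ ∑ a ∈ Λ, ∑ b ∈ Λ, (2 + if a + b = 0 then (latticeCount n : ℝ) else 0) :=
          Finset.sum_le_sum fun a _ => Finset.sum_le_sum fun b _ => inner (a + b)
      _ = ∑ a ∈ Λ, (2 * (latticeCount n : ℝ) + latticeCount n) := by
          refine Finset.sum_congr rfl fun a ha => ?_
          simp only [Finset.sum_add_distrib, add_eq_zero_iff_neg_eq]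
          rw [Finset.sum_ite_eq, if_pos (neg_mem_latticePoints ha)]
          simp [latticeCount, hΛ, mul_comm]
      _ = _ := by
          rw [Finset.sum_const, nsmul_eq_mul, hΛ, ← latticeCount]; ring
  calc _ ≤ (latticeCount n : ℝ)⁻¹ ^ 4 * (3 * (latticeCount n : ℝ) ^ 2) := by gcongr
    _ = _ := by field_simp

/-! ### The central binomial series -/

/-- The Taylor coefficients of `1 / √(1 - t)`. -/
def centralCoeff (q : ℕ) : ℝ := (Nat.centralBinom q : ℝ) / 4 ^ q

theorem centralCoeff_pos (q : ℕ) : 0 < centralCoeff q := by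
  have : 0 < Nat.centralBinom q := Nat.centralBinom_pos q
  unfold centralCoeff
  positivity

theorem centralCoeff_zero : centralCoeff 0 = 1 := by simp [centralCoeff]

theorem centralCoeff_one : centralCoeff 1 = 1 / 2 := by
  norm_num [centralCoeff, Nat.centralBinom, Nat.choose]

theorem succ_mul_centralCoeff_succ (q : ℕ) :
    (q + 1 : ℝ) * centralCoeff (q + 1) = (q + 1 / 2) * centralCoeff q := by
  have h : ((q + 1 : ℕ) : ℝ) * Nat.centralBinom (q + 1) = 2 * (2 * q + 1) * Nat.centralBinom q := by
    exact_mod_cast Nat.succ_mul_centralBinom_succ q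
  unfold centralCoeff
  push_cast at h
  rw [mul_div_assoc', h]
  field_simp
  ring

/-- Identifies the binomial series of `(1 - t) ^ (-1/2)`: both sides obey the recurrence of the
ascending Pochhammer symbol at `1/2`. -/
theorem choose_half_eq_centralCoeff (q : ℕ) :
    Ring.choose ((1 / 2 : ℝ) + q - 1) q = centralCoeff q := by
  rw [← Ring.multichoose_eq]
  induction q with
  | zero => simp [centralCoeff_zero]
  | succ q ih =>
    have h1 := Ring.factorial_nsmul_multichoose_eq_ascPochhammer (1 / 2 : ℝ) (q + 1)
    have h0 := Ring.factorial_nsmul_multichoose_eq_ascPochhammer (1 / 2 : ℝ) q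
    rw [ascPochhammer_succ_right, Polynomial.smeval_mul, ← h0, ih] at h1
    simp only [nsmul_eq_mul, Polynomial.smeval_add, Polynomial.smeval_X, pow_one,
      Polynomial.smeval_natCast, pow_zero, Nat.factorial_succ, Nat.cast_mul, mul_one] at h1
    have h2 := succ_mul_centralCoeff_succ q
    have hf : (q.factorial : ℝ) ≠ 0 := by exact_mod_cast q.factorial_ne_zero
    have hq : (q + 1 : ℝ) ≠ 0 := by positivity
    apply mul_left_cancel₀ hf
    apply mul_left_cancel₀ hq
    push_cast at h1
    linear_combination h1 - q.factorial * h2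

theorem hasSum_centralCoeff {t : ℝ} (h0 : 0 ≤ t) (h1 : t < 1) :
    HasSum (fun q => centralCoeff q * t ^ q) (1 / Real.sqrt (1 - t)) := by
  have h := (Real.one_div_one_sub_rpow_hasFPowerSeriesOnBall_zero (1 / 2)).hasSum (y := t) (by
    rw [Metric.mem_eball, edist_zero_right, ← ofReal_norm, Real.norm_of_nonneg h0]
    simpa using h1)
  simpa only [FormalMultilinearSeries.ofScalars_apply_eq, zero_add, smul_eq_mul,
    choose_half_eq_centralCoeff, ← Real.sqrt_eq_rpow] using h

/-- The sum telescopes: `c_q - c_{q+1} = c_q / (2q + 2)`, which is at least half of `c_q / (2q +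
1)`, and `c_K ≤ 1`. -/
theorem sum_centralCoeff_div_le (K M : ℕ) :
    ∑ j ∈ Finset.range M, centralCoeff (K + j) / (2 * (K + j : ℕ) + 1) ≤ 2 := by
  have hstep : ∀ q : ℕ, centralCoeff q / (2 * q + 1) ≤ 2 * (centralCoeff q - centralCoeff (q + 1)) := by
    intro q
    have h := succ_mul_centralCoeff_succ q
    have hp := centralCoeff_pos q
    have e : centralCoeff q - centralCoeff (q + 1) = centralCoeff q / (2 * q + 2) := by
      field_simp
      linear_combination -2 * h
    rw [e, div_le_iff₀ (by positivity)]
    have : 2 * (centralCoeff q / (2 * q + 2)) * (2 * q + 1) =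
        centralCoeff q * ((2 * (2 * q + 1)) / (2 * q + 2)) := by ring
    rw [this]
    refine le_mul_of_one_le_right hp.le ?_
    rw [one_le_div (by positivity)]
    have : (0 : ℝ) ≤ q := by positivity
    linarith
  have hanti : ∀ q, centralCoeff q ≤ 1 := by
    intro q
    induction q with
    | zero => rw [centralCoeff_zero]
    | succ q ih =>
      have h1 := hstep q
      have h2 : 0 ≤ centralCoeff q / (2 * q + 1) := by have := centralCoeff_pos q; positivity
      linarith
  calc _ ≤ ∑ j ∈ Finset.range M, 2 * (centralCoeff (K + j) - centralCoeff (K + (j + 1))) :=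
        Finset.sum_le_sum fun j _ => hstep (K + j)
    _ = 2 * (centralCoeff K - centralCoeff (K + M)) := by
        rw [← Finset.mul_sum, Finset.sum_range_sub' fun j => centralCoeff (K + j)]
        simp
    _ ≤ 2 := by linarith [hanti K, centralCoeff_pos (K + M)]

/-- The decay of the moments supplies the factor `1 / (2q + 1)`; without it the coefficients `c_q`,
of order `q ^ (-1/2)`, would not be summable. -/
theorem sum_centralCoeff_mul_integral_le (n : ℕ) (hn : n ∈ sumsOfTwoSquares) (hn0 : 0 < n)
    (K M : ℕ) :
    ∑ j ∈ Finset.range M, centralCoeff (K + j) * ∫ x, waveCov n x ^ (2 * (K + j))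
      ≤ 2 * (2 * K + 1) * ∫ x, waveCov n x ^ (2 * K) := by
  have hI := integral_waveCov_pow_nonneg n K
  calc _ ≤ ∑ j ∈ Finset.range M, centralCoeff (K + j) / (2 * (K + j : ℕ) + 1) *
        ((2 * K + 1) * ∫ x, waveCov n x ^ (2 * K)) := by
        refine Finset.sum_le_sum fun j _ => ?_
        have h := integral_waveCov_pow_le n hn hn0 K j
        rw [div_mul_eq_mul_div, le_div_iff₀ (by positivity), mul_assoc,
          mul_comm _ (2 * ((K + j : ℕ) : ℝ) + 1)]
        exact mul_le_mul_of_nonneg_left h (centralCoeff_pos _).le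
    _ ≤ 2 * ((2 * K + 1) * ∫ x, waveCov n x ^ (2 * K)) := by
        rw [← Finset.sum_mul]
        exact mul_le_mul_of_nonneg_right (sum_centralCoeff_div_le K M) (by positivity)
    _ = _ := by ring

theorem summable_centralCoeff_mul_integral (n : ℕ) (hn : n ∈ sumsOfTwoSquares) (hn0 : 0 < n)
    (K : ℕ) :
    Summable fun j => centralCoeff (K + j) * ∫ x, waveCov n x ^ (2 * (K + j)) :=
  summable_of_sum_range_le
    (fun _ => mul_nonneg (centralCoeff_pos _).le (integral_waveCov_pow_nonneg n _))
    (sum_centralCoeff_mul_integral_le n hn hn0 K)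

theorem tsum_centralCoeff_mul_integral_le (n : ℕ) (hn : n ∈ sumsOfTwoSquares) (hn0 : 0 < n)
    (K : ℕ) :
    ∑' j, centralCoeff (K + j) * ∫ x, waveCov n x ^ (2 * (K + j))
      ≤ 2 * (2 * K + 1) * ∫ x, waveCov n x ^ (2 * K) :=
  Real.tsum_le_of_sum_range_le
    (fun _ => mul_nonneg (centralCoeff_pos _).le (integral_waveCov_pow_nonneg n _))
    (sum_centralCoeff_mul_integral_le n hn hn0 K)

/-- Termwise integration of a series of nonnegative functions. The tail bound with `K = 0` makes the
integrals summable, which is what tames the singularities at the points where `r² = 1`. -/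
theorem hasSum_integral_inv_sqrt (n : ℕ) (hn : n ∈ sumsOfTwoSquares) (hn0 : 0 < n) :
    HasSum (fun q => centralCoeff q * ∫ x, waveCov n x ^ (2 * q))
      (∫ x, 1 / Real.sqrt (1 - waveCov n x ^ 2)) ∧
    Integrable fun x => 1 / Real.sqrt (1 - waveCov n x ^ 2) := by
  have hs := summable_centralCoeff_mul_integral n hn hn0 0
  simp only [zero_add] at hs
  have hnn : ∀ q x, 0 ≤ centralCoeff q * waveCov n x ^ (2 * q) := fun q x =>
    mul_nonneg (centralCoeff_pos q).le ((even_two_mul q).pow_nonneg _)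
  have hint : ∀ q, Integrable fun x => centralCoeff q * waveCov n x ^ (2 * q) := fun q =>
    (integrable_waveCov_pow n _).const_mul _
  have hnorm : Summable fun q => ∫ x, ‖centralCoeff q * waveCov n x ^ (2 * q)‖ := by
    simp only [Real.norm_of_nonneg (hnn _ _), integral_const_mul]
    exact hs
  have hae : ∀ᵐ x : Torus, HasSum (fun q => centralCoeff q * waveCov n x ^ (2 * q))
      (1 / Real.sqrt (1 - waveCov n x ^ 2)) := by
    filter_upwards [ae_waveCov_sq_lt_one n hn hn0] with x hx
    simpa only [pow_mul] using hasSum_centralCoeff (sq_nonneg (waveCov n x)) hx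
  have htsum : (fun x => ∑' q, centralCoeff q * waveCov n x ^ (2 * q)) =ᵐ[volume]
      fun x => 1 / Real.sqrt (1 - waveCov n x ^ 2) := by
    filter_upwards [hae] with x hx using hx.tsum_eq
  refine ⟨?_, ?_⟩
  · have h := hasSum_integral_of_summable_integral_norm hint hnorm
    rw [integral_congr_ae htsum] at h
    simpa only [integral_const_mul] using h
  · refine ⟨Measurable.aestronglyMeasurable (by fun_prop), ?_⟩
    rw [hasFiniteIntegral_iff_enorm]
    have e : ∫⁻ x : Torus, ‖1 / Real.sqrt (1 - waveCov n x ^ 2)‖ₑ =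
        ∫⁻ x : Torus, ∑' q, ENNReal.ofReal (centralCoeff q * waveCov n x ^ (2 * q)) := by
      refine lintegral_congr_ae ?_
      filter_upwards [hae] with x hx
      rw [← ENNReal.ofReal_tsum_of_nonneg (fun q => hnn q x) hx.summable, hx.tsum_eq,
        Real.enorm_of_nonneg (by positivity)]
    rw [e, lintegral_tsum fun q => by fun_prop]
    simp only [← ofReal_integral_eq_lintegral_ofReal (hint _) (Eventually.of_forall (hnn _)),
      integral_const_mul]
    rw [← ENNReal.ofReal_tsum_of_nonneg (fun q => mul_nonneg (centralCoeff_pos q).le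
      (integral_waveCov_pow_nonneg n q)) hs]
    exact ENNReal.ofReal_lt_top

/-! ### Hermite polynomials. -/

/-- The value at `x` of the `p`-th probabilists' Hermite polynomial. -/
def hermiteFun (p : ℕ) (x : ℝ) : ℝ := Polynomial.aeval x (Polynomial.hermite p)

theorem derivative_hermite_succ (n : ℕ) :
    Polynomial.derivative (Polynomial.hermite (n + 1)) = (n + 1 : ℕ) * Polynomial.hermite n := by
  induction n with
  | zero => simp [Polynomial.hermite_zero]
  | succ n ih =>
    rw [Polynomial.hermite_succ (n + 1), Polynomial.derivative_sub, Polynomial.derivative_mul,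
      Polynomial.derivative_X, ih, Polynomial.derivative_natCast_mul]
    have h := Polynomial.hermite_succ n
    push_cast
    linear_combination -((n : Polynomial ℤ) + 1) * h

theorem hermiteFun_zero (x : ℝ) : hermiteFun 0 x = 1 := by simp [hermiteFun]

theorem hermiteFun_succ (p : ℕ) (x : ℝ) : hermiteFun (p + 1) x =
    x * hermiteFun p x - Polynomial.aeval x (Polynomial.derivative (Polynomial.hermite p)) := by
  simp [hermiteFun, Polynomial.hermite_succ]

theorem hasDerivAt_hermiteFun (p : ℕ) (x : ℝ) : HasDerivAt (hermiteFun p)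
    (Polynomial.aeval x (Polynomial.derivative (Polynomial.hermite p))) x :=
  Polynomial.hasDerivAt_aeval _ x

@[fun_prop]
theorem continuous_hermiteFun (p : ℕ) : Continuous (hermiteFun p) :=
  continuous_iff_continuousAt.mpr fun x => (hasDerivAt_hermiteFun p x).continuousAt

theorem hasDerivAt_hermiteFun_succ (p : ℕ) (x : ℝ) :
    HasDerivAt (hermiteFun (p + 1)) ((p + 1) * hermiteFun p x) x := by
  refine (hasDerivAt_hermiteFun (p + 1) x).congr_deriv ?_
  rw [derivative_hermite_succ]
  simp [hermiteFun]

theorem hermiteFun_add_two_zero (p : ℕ) : hermiteFun (p + 2) 0 = -(p + 1) * hermiteFun p 0 := by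
  rw [hermiteFun_succ, derivative_hermite_succ]
  simp only [hermiteFun, zero_mul, zero_sub, map_mul, map_natCast]
  push_cast
  ring

/-- `H_{2m}(0)` is `±(2m - 1)!!`. This is why the variances of the chaotic components are the terms
of the series of `1 / √(1 - r²)`. -/
theorem hermiteFun_two_mul_zero_sq (m : ℕ) :
    hermiteFun (2 * m) 0 ^ 2 = (2 * m).factorial * centralCoeff m := by
  induction m with
  | zero => simp [hermiteFun_zero, centralCoeff_zero]
  | succ m ih =>
    have h := succ_mul_centralCoeff_succ m
    rw [mul_add, mul_one, hermiteFun_add_two_zero, mul_pow, ih, Nat.factorial_succ,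
      Nat.factorial_succ]
    push_cast
    linear_combination -(2 * (2 * m + 1) * (2 * m).factorial) * h

/-! ### Gaussian integration by parts -/

theorem integrable_aeval_gaussianReal (p : Polynomial ℤ) :
    Integrable (fun x : ℝ => Polynomial.aeval x p) (gaussianReal 0 1) := by
  induction p using Polynomial.induction_on' with
  | add p q hp hq =>
    simp only [map_add]
    exact hp.add hq
  | monomial n c =>
    simp only [Polynomial.aeval_monomial]
    refine Integrable.const_mul ?_ _
    rcases Nat.eq_zero_or_pos n with rfl | hn
    · simp
    · have h := memLp_id_gaussianReal' (μ := 0) (v := 1) (n : ℝ≥0∞) (by simp)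
      have h2 := h.integrable_norm_pow hn.ne'
      exact (integrable_norm_iff (by fun_prop)).mp (by simpa using h2)

theorem integrable_complexOfReal {α : Type*} [MeasurableSpace α] {μ : Measure α} {f : α → ℝ}
    (h : Integrable f μ) : Integrable (fun x => (f x : ℂ)) μ := h.ofReal

theorem integrable_hermiteFun (p : ℕ) : Integrable (hermiteFun p) (gaussianReal 0 1) :=
  integrable_aeval_gaussianReal _

theorem integrable_hermiteFun_mul (p q : ℕ) :
    Integrable (fun x => hermiteFun p x * hermiteFun q x) (gaussianReal 0 1) := by
  simpa [hermiteFun] using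
    integrable_aeval_gaussianReal (Polynomial.hermite p * Polynomial.hermite q)

theorem memLp_hermiteFun (p : ℕ) : MemLp (hermiteFun p) 2 (gaussianReal 0 1) := by
  rw [memLp_two_iff_integrable_sq (by fun_prop)]
  simpa [pow_two] using integrable_hermiteFun_mul p p

theorem integrable_gaussianReal_iff {f : ℝ → ℂ} :
    Integrable f (gaussianReal 0 1) ↔ Integrable fun x => (gaussianPDFReal 0 1 x : ℂ) * f x := by
  rw [gaussianReal_of_var_ne_zero _ one_ne_zero, integrable_withDensity_iff_integrable_smul'
    (by fun_prop) (Eventually.of_forall fun x => gaussianPDF_lt_top)]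
  simp [toReal_gaussianPDF]

theorem hasDerivAt_gaussianPDFReal (x : ℝ) :
    HasDerivAt (gaussianPDFReal 0 1) (-x * gaussianPDFReal 0 1 x) x := by
  have h : HasDerivAt (fun x : ℝ => (√(2 * Real.pi))⁻¹ * Real.exp (-x ^ 2 / 2))
      ((√(2 * Real.pi))⁻¹ * (Real.exp (-x ^ 2 / 2) * (-(2 * x) / 2))) x := by
    have h1 : HasDerivAt (fun x : ℝ => -x ^ 2 / 2) (-(2 * x) / 2) x := by
      simpa using ((hasDerivAt_pow 2 x).neg).div_const 2
    exact (h1.exp).const_mul _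
  have e : gaussianPDFReal 0 1 = fun x : ℝ => (√(2 * Real.pi))⁻¹ * Real.exp (-x ^ 2 / 2) := by
    funext x; simp [gaussianPDFReal]
  rw [e]
  exact h.congr_deriv (by ring)

/-- With `φ` the Gaussian density, `(H_p φ)' = -H_{p+1} φ`, so one degree is traded for one
derivative of `f`. Complex values of `f` are allowed for the sake of exponentials. -/
theorem integral_mul_hermiteFun_succ {f f' : ℝ → ℂ} (p : ℕ) (hf : ∀ x, HasDerivAt f (f' x) x)
    (h0 : Integrable (fun x => f x * hermiteFun p x) (gaussianReal 0 1))
    (h1 : Integrable (fun x => f' x * hermiteFun p x) (gaussianReal 0 1))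
    (h2 : Integrable (fun x => f x * hermiteFun (p + 1) x) (gaussianReal 0 1)) :
    ∫ x, f x * hermiteFun (p + 1) x ∂gaussianReal 0 1
      = ∫ x, f' x * hermiteFun p x ∂gaussianReal 0 1 := by
  simp only [integral_gaussianReal_eq_integral_smul one_ne_zero, Complex.real_smul]
  have hv : ∀ x : ℝ, HasDerivAt (fun x : ℝ => ((hermiteFun p x * gaussianPDFReal 0 1 x : ℝ) : ℂ))
      ((-(hermiteFun (p + 1) x * gaussianPDFReal 0 1 x) : ℝ) : ℂ) x := by
    intro x
    have := ((hasDerivAt_hermiteFun p x).mul (hasDerivAt_gaussianPDFReal x))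
    refine (this.congr_deriv ?_).ofReal_comp
    rw [hermiteFun_succ]; ring
  have key := integral_mul_deriv_eq_deriv_mul_of_integrable (fun x _ => hf x) (fun x _ => hv x)
    (by convert (integrable_gaussianReal_iff.mp h2).neg using 1
        funext x; simp; ring)
    (by convert (integrable_gaussianReal_iff.mp h1) using 1
        funext x; simp; ring)
    (by convert (integrable_gaussianReal_iff.mp h0) using 1
        funext x; simp; ring)
  rw [← neg_inj, ← integral_neg]
  refine Eq.trans (integral_congr_ae (Eventually.of_forall fun x => ?_)) (key.trans ?_)
  · simp; ring
  · congr 1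
    refine integral_congr_ae (Eventually.of_forall fun x => ?_)
    simp; ring

theorem integral_hermiteFun_succ (p : ℕ) : ∫ x, hermiteFun (p + 1) x ∂gaussianReal 0 1 = 0 := by
  have h := integral_mul_hermiteFun_succ (f := fun _ => 1) (f' := fun _ => 0) p
    (fun x => hasDerivAt_const x 1) (by simp only [one_mul]; exact integrable_complexOfReal (integrable_hermiteFun p))
    (by simp) (by simp only [one_mul]; exact integrable_complexOfReal (integrable_hermiteFun (p + 1)))
  simp only [one_mul, zero_mul, integral_zero] at h
  rw [integral_complex_ofReal] at h
  exact_mod_cast h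

theorem integral_hermiteFun_sq (p : ℕ) :
    ∫ x, hermiteFun p x * hermiteFun p x ∂gaussianReal 0 1 = p.factorial := by
  induction p with
  | zero => simp [hermiteFun_zero]
  | succ p ih =>
    have h := integral_mul_hermiteFun_succ (f := fun x => hermiteFun (p + 1) x)
      (f' := fun x => ((p + 1) * hermiteFun p x : ℝ)) p
      (fun x => (hasDerivAt_hermiteFun_succ p x).ofReal_comp)
      (by simp only [← Complex.ofReal_mul]
          exact integrable_complexOfReal (integrable_hermiteFun_mul (p + 1) p))
      (by simp only [← Complex.ofReal_mul, mul_assoc]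
          exact integrable_complexOfReal ((integrable_hermiteFun_mul p p).const_mul ((p : ℝ) + 1)))
      (by simp only [← Complex.ofReal_mul]
          exact integrable_complexOfReal (integrable_hermiteFun_mul (p + 1) (p + 1)))
    simp only [← Complex.ofReal_mul, mul_assoc] at h
    rw [integral_complex_ofReal, integral_complex_ofReal, integral_const_mul, ih] at h
    rw [Nat.factorial_succ]
    exact_mod_cast h

theorem integrable_exp_mul_hermiteFun (s : ℝ) (p : ℕ) :
    Integrable (fun x : ℝ => Complex.exp (s * x * Complex.I) * hermiteFun p x)
      (gaussianReal 0 1) := by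
  refine (integrable_complexOfReal (integrable_hermiteFun p)).bdd_mul (c := 1) (by fun_prop)
    (Eventually.of_forall fun x => ?_)
  rw [← Complex.ofReal_mul, Complex.norm_exp_ofReal_mul_I]

/-- Each integration by parts produces a factor `is`; what remains is the characteristic function.
-/
theorem integral_exp_mul_hermiteFun (s : ℝ) (p : ℕ) :
    ∫ x : ℝ, Complex.exp (s * x * Complex.I) * hermiteFun p x ∂gaussianReal 0 1
      = (s * Complex.I) ^ p * Complex.exp (-s ^ 2 / 2) := by
  induction p with
  | zero =>
    have h := charFun_gaussianReal (μ := 0) (v := 1) s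
    rw [charFun_apply_real] at h
    simpa [hermiteFun_zero, neg_div] using h
  | succ p ih =>
    rw [integral_mul_hermiteFun_succ (f' := fun x => s * Complex.I * Complex.exp (s * x * Complex.I))
      p ?_ (integrable_exp_mul_hermiteFun s p) ?_ (integrable_exp_mul_hermiteFun s (p + 1))]
    · simp only [mul_assoc ((s : ℂ) * Complex.I)]
      rw [integral_const_mul, ih]
      ring
    · intro x
      have h1 : HasDerivAt (fun x : ℝ => (s : ℂ) * x * Complex.I) (s * 1 * Complex.I) x :=
        (Complex.ofRealCLM.hasDerivAt.const_mul (s : ℂ)).mul_const _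
      exact h1.cexp.congr_deriv (by ring)
    · simp only [mul_assoc ((s : ℂ) * Complex.I)]
      exact (integrable_exp_mul_hermiteFun s p).const_mul _

/-! ### Averages over small intervals -/

/-- The approximation `(2ε)⁻¹ 1_{(-ε, ε)}` of the Dirac mass at the origin. -/
def deltaApprox (ε : ℝ) : ℝ → ℝ := (Set.Ioo (-ε) ε).indicator fun _ => (2 * ε)⁻¹

@[fun_prop]
theorem measurable_deltaApprox (ε : ℝ) : Measurable (deltaApprox ε) :=
  measurable_const.indicator measurableSet_Ioo

theorem deltaApprox_nonneg {ε : ℝ} (hε : 0 < ε) (x : ℝ) : 0 ≤ deltaApprox ε x :=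
  Set.indicator_nonneg (fun _ _ => by positivity) _

theorem norm_deltaApprox_le {ε : ℝ} (hε : 0 < ε) (x : ℝ) : ‖deltaApprox ε x‖ ≤ (2 * ε)⁻¹ := by
  rw [Real.norm_of_nonneg (deltaApprox_nonneg hε x)]
  exact Set.indicator_le_self' (fun _ _ => by positivity) _

/-- The symmetric average is half the sum of the two one-sided difference quotients at `0` of a
primitive of `g`. -/
theorem tendsto_average_Ioo {g : ℝ → ℝ} (hg : Continuous g) :
    Tendsto (fun ε => ∫ x, deltaApprox ε x * g x) (𝓝[>] 0) (𝓝 (g 0)) := by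
  have hd : HasDerivAt (fun u => ∫ x in (0 : ℝ)..u, g x) (g 0) 0 :=
    intervalIntegral.integral_hasDerivAt_right (by simp) hg.aestronglyMeasurable.stronglyMeasurableAtFilter
      hg.continuousAt
  have h1 := hd.tendsto_slope_zero_right
  have h2 := hd.tendsto_slope_zero_left
  have h3 := h2.comp (show Tendsto (fun x : ℝ => -x) (𝓝[>] 0) (𝓝[<] 0) by
    simpa using tendsto_neg_nhdsGT (a := (0 : ℝ)))
  have h4 := (h1.add h3).const_mul (1 / 2)
  have e : 1 / 2 * (g 0 + g 0) = g 0 := by ring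
  rw [e] at h4
  refine h4.congr' ?_
  filter_upwards [self_mem_nhdsWithin] with ε (hε : 0 < ε)
  have e2 : ∫ x, deltaApprox ε x * g x = (2 * ε)⁻¹ * ∫ x in (-ε)..ε, g x := by
    rw [intervalIntegral.integral_of_le (by linarith), integral_Ioc_eq_integral_Ioo,
      ← integral_const_mul, ← integral_indicator measurableSet_Ioo]
    refine integral_congr_ae (Eventually.of_forall fun x => ?_)
    simp only [deltaApprox, Set.indicator_apply]
    split_ifs <;> simp
  rw [e2, ← intervalIntegral.integral_add_adjacent_intervals (hg.intervalIntegrable (-ε) 0)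
    (hg.intervalIntegrable 0 ε), intervalIntegral.integral_symm 0 (-ε)]
  simp
  field_simp
  ring

theorem tendsto_integral_deltaApprox_mul_hermiteFun (q : ℕ) :
    Tendsto (fun ε => ∫ x, deltaApprox ε x * hermiteFun q x ∂gaussianReal 0 1) (𝓝[>] 0)
      (𝓝 ((√(2 * Real.pi))⁻¹ * hermiteFun q 0)) := by
  have hc : Continuous (gaussianPDFReal 0 1) :=
    continuous_iff_continuousAt.mpr fun x => (hasDerivAt_gaussianPDFReal x).continuousAt
  have h := tendsto_average_Ioo (g := fun x => gaussianPDFReal 0 1 x * hermiteFun q x)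
    (hc.mul (continuous_hermiteFun q))
  have e : gaussianPDFReal 0 1 0 = (√(2 * Real.pi))⁻¹ := by simp [gaussianPDFReal]
  rw [e] at h
  refine h.congr fun ε => ?_
  rw [integral_gaussianReal_eq_integral_smul one_ne_zero]
  refine integral_congr_ae (Eventually.of_forall fun x => ?_)
  simp only [smul_eq_mul]
  ring

section

variable {Ω : Type*} [MeasurableSpace Ω]

/-! ### Centred Gaussian variables in `L²` -/

theorem norm_sq_eq_integral_sq {P : Measure Ω} (ξ : Lp ℝ 2 P) : ‖ξ‖ ^ 2 = ∫ ω, ξ ω ^ 2 ∂P := by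
  rw [← real_inner_self_eq_norm_sq, L2.inner_def]
  simp [pow_two]

theorem inner_eq_integral_mul {P : Measure Ω} (ξ η : Lp ℝ 2 P) :
    inner ℝ ξ η = ∫ ω, ξ ω * η ω ∂P := by
  rw [L2.inner_def]
  simp [mul_comm]

theorem aemeasurable_Lp {P : Measure Ω} (ξ : Lp ℝ 2 P) : AEMeasurable ξ P :=
  (Lp.aestronglyMeasurable ξ).aemeasurable

theorem hasLaw_of_charFun_eq {P : Measure Ω} [IsProbabilityMeasure P] {ξ : Lp ℝ 2 P}
    (h : ∀ t : ℝ, ∫ ω, Complex.exp (t * ξ ω * Complex.I) ∂P = Complex.exp (-(t ^ 2 * ‖ξ‖ ^ 2 / 2))) :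
    HasLaw ξ (gaussianReal 0 (‖ξ‖₊ ^ 2)) P where
  aemeasurable := aemeasurable_Lp ξ
  map_eq := by
    have : IsProbabilityMeasure (P.map ξ) := Measure.isProbabilityMeasure_map (aemeasurable_Lp ξ)
    refine Measure.ext_of_charFun (funext fun t => ?_)
    rw [charFun_gaussianReal, charFun_apply_real, integral_map (aemeasurable_Lp ξ) (by fun_prop), h]
    congr 1
    simp
    ring

theorem charFun_eq_of_hasGaussianLaw {P : Measure Ω} [IsProbabilityMeasure P] {ξ : Lp ℝ 2 P}
    (h : HasGaussianLaw ξ P) (h0 : ∫ ω, ξ ω ∂P = 0) (t : ℝ) :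
    ∫ ω, Complex.exp (t * ξ ω * Complex.I) ∂P = Complex.exp (-(t ^ 2 * ‖ξ‖ ^ 2 / 2)) := by
  have h1 := h.map_eq_gaussianReal
  rw [h0, variance_of_integral_eq_zero (aemeasurable_Lp ξ) h0, ← norm_sq_eq_integral_sq] at h1
  have h2 := charFun_gaussianReal (μ := 0) (v := (‖ξ‖ ^ 2).toNNReal) t
  rw [← h1, charFun_apply_real, integral_map (aemeasurable_Lp ξ) (by fun_prop)] at h2
  rw [h2]
  congr 1
  rw [Real.coe_toNNReal _ (by positivity)]
  push_cast
  ring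

/-- The exponential is `|t|`-Lipschitz and the `L¹` norm is at most the `L²` norm. It serves to
carry Gaussian laws over to closures in `L²`. -/
theorem continuous_integral_exp {P : Measure Ω} [IsProbabilityMeasure P] (t : ℝ) :
    Continuous fun ξ : Lp ℝ 2 P => ∫ ω, Complex.exp (t * ξ ω * Complex.I) ∂P := by
  have hint : ∀ ξ : Lp ℝ 2 P, Integrable (fun ω => Complex.exp (t * ξ ω * Complex.I)) P := by
    intro ξ
    refine Integrable.of_bound (C := 1) ?_ (Eventually.of_forall fun ω => ?_)
    · have := Lp.aestronglyMeasurable ξ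
      have h2 : Continuous fun x : ℝ => Complex.exp (t * x * Complex.I) := by fun_prop
      exact h2.comp_aestronglyMeasurable this
    · rw [← Complex.ofReal_mul, Complex.norm_exp_ofReal_mul_I]
  refine LipschitzWith.continuous (K := ‖t‖₊) (LipschitzWith.of_dist_le_mul fun ξ η => ?_)
  rw [dist_eq_norm, dist_eq_norm, ← integral_sub (hint ξ) (hint η)]
  have hpt : ∀ x y : ℝ, ‖Complex.exp (t * x * Complex.I) - Complex.exp (t * y * Complex.I)‖
      ≤ ‖t‖ * ‖x - y‖ := by
    intro x y
    have e : Complex.exp (t * x * Complex.I) - Complex.exp (t * y * Complex.I) =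
        Complex.exp ((t * y : ℝ) * Complex.I) *
          (Complex.exp (Complex.I * (t * (x - y) : ℝ)) - 1) := by
      rw [mul_sub, ← Complex.exp_add, mul_one]
      congr 2
      · push_cast; ring
      · push_cast; ring
    rw [e, norm_mul, Complex.norm_exp_ofReal_mul_I, one_mul, ← norm_mul]
    exact Real.norm_exp_I_mul_ofReal_sub_one_le
  have hsub : Integrable (fun ω => ‖(ξ - η) ω‖) P :=
    ((Lp.memLp (ξ - η)).integrable (by norm_num)).norm
  calc _ ≤ ∫ ω, ‖t‖ * ‖(ξ - η) ω‖ ∂P := by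
        refine (norm_integral_le_integral_norm _).trans (integral_mono_ae
          ((hint ξ).sub (hint η)).norm (hsub.const_mul _) ?_)
        filter_upwards [Lp.coeFn_sub ξ η] with ω hω
        rw [hω]
        exact hpt _ _
    _ = ‖t‖ * ∫ ω, ‖(ξ - η) ω‖ ∂P := integral_const_mul _ _
    _ ≤ ‖t‖ * ‖ξ - η‖ := by
        gcongr
        rw [Lp.norm_def, integral_norm_eq_lintegral_enorm (Lp.aestronglyMeasurable _),
          ← eLpNorm_one_eq_lintegral_enorm]
        exact ENNReal.toReal_mono (Lp.eLpNorm_ne_top _)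
          (eLpNorm_le_eLpNorm_of_exponent_le (by norm_num) (Lp.aestronglyMeasurable _))

/-! ### The Gaussian space generated by the coefficients -/

theorem hasGaussianLaw_re_mul {a : (Fin 2 → ℤ) → Ω → ℂ} {P : Measure Ω} [IsProbabilityMeasure P]
    (ha : IsGaussianCoefficients a P) {l : Fin 2 → ℤ} (hl : l ≠ 0) (z : ℂ) :
    HasGaussianLaw (fun ω => (z * a l ω).re) P := by
  have h1 : HasGaussianLaw (fun ω => (a l ω).re) P := (ha.hasLaw_re l hl).hasGaussianLaw
  have h2 : HasGaussianLaw (fun ω => (a l ω).im) P := (ha.hasLaw_im l hl).hasGaussianLaw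
  have hi : IndepFun (fun ω => z.re • (a l ω).re) (fun ω => z.im • (a l ω).im) P :=
    (ha.indep_re_im l hl).comp (φ := fun x => z.re • x) (ψ := fun x => z.im • x)
      (by fun_prop) (by fun_prop)
  have := iIndepFun.hasGaussianLaw_fun_sub (h1.fun_smul z.re) (h2.fun_smul z.im) hi
  simpa [Complex.mul_re] using this

theorem integral_re_mul {a : (Fin 2 → ℤ) → Ω → ℂ} {P : Measure Ω} [IsProbabilityMeasure P]
    (ha : IsGaussianCoefficients a P) {l : Fin 2 → ℤ} (hl : l ≠ 0) (z : ℂ) :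
    ∫ ω, (z * a l ω).re ∂P = 0 := by
  have h1 : HasGaussianLaw (fun ω => (a l ω).re) P := (ha.hasLaw_re l hl).hasGaussianLaw
  have h2 : HasGaussianLaw (fun ω => (a l ω).im) P := (ha.hasLaw_im l hl).hasGaussianLaw
  simp only [Complex.mul_re]
  rw [integral_sub (h1.integrable.const_mul _) (h2.integrable.const_mul _), integral_const_mul,
    integral_const_mul, (ha.hasLaw_re l hl).integral_eq, (ha.hasLaw_im l hl).integral_eq]
  simp [integral_id_gaussianReal]

theorem ne_zero_of_mem_halfLattice {l : Fin 2 → ℤ} (h : l ∈ halfLattice) : l ≠ 0 := by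
  rintro rfl
  simp [halfLattice] at h

theorem mem_or_neg_mem_halfLattice {l : Fin 2 → ℤ} (h : l ≠ 0) :
    l ∈ halfLattice ∨ -l ∈ halfLattice := by
  simp only [halfLattice, Set.mem_ofPred_eq, Pi.neg_apply]
  by_contra! hcon
  have h1 : l 1 = 0 := by omega
  have h0 : l 0 = 0 := by omega
  exact h (funext fun i => by fin_cases i <;> simp [h0, h1])

/-- Every element of the span of the generators is a finite combination of the independent
coefficients. -/
theorem exists_finsupp_of_mem_span {a : (Fin 2 → ℤ) → Ω → ℂ} {P : Measure Ω}
    (ha : IsGaussianCoefficients a P) {ξ : Lp ℝ 2 P}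
    (hξ : ξ ∈ Submodule.span ℝ {ξ : Lp ℝ 2 P | ∃ (l : Fin 2 → ℤ) (z : ℂ), l ≠ 0 ∧
      ∀ᵐ ω ∂P, ((ξ ω : ℝ) : ℂ) = z * a l ω + conj z * a (-l) ω}) :
    ∃ c : halfLattice →₀ ℂ, ξ =ᵐ[P] fun ω => c.sum fun l z => (z * a l ω).re := by
  induction hξ using Submodule.span_induction with
  | mem ξ h =>
    obtain ⟨l, z, hl, h⟩ := h
    rcases mem_or_neg_mem_halfLattice hl with hl' | hl'
    -- The factor 2 arises because `z a_l` plus its conjugate is twice its real part. In the other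
    -- case the representative is `-l`, with the conjugate coefficient.
    · refine ⟨Finsupp.single ⟨l, hl'⟩ (2 * z), ?_⟩
      filter_upwards [h, ha.conj_eq l hl] with ω h1 h2
      rw [Finsupp.sum_single_index (by simp)]
      rw [← h2, ← map_mul, Complex.add_conj] at h1
      rw [mul_assoc]
      simpa using congrArg Complex.re h1
    · refine ⟨Finsupp.single ⟨-l, hl'⟩ (2 * conj z), ?_⟩
      filter_upwards [h, ha.conj_eq (-l) (neg_ne_zero.mpr hl)] with ω h1 h2
      rw [Finsupp.sum_single_index (by simp)]
      rw [neg_neg] at h2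
      have e : z * a l ω = conj (conj z * a (-l) ω) := by simp [h2]
      rw [e, add_comm, Complex.add_conj] at h1
      rw [mul_assoc]
      simpa using congrArg Complex.re h1
  | zero =>
    refine ⟨0, ?_⟩
    filter_upwards [Lp.coeFn_zero ℝ 2 P] with ω hω
    rw [Finsupp.sum_zero_index]
    exact hω
  | add ξ η _ _ h1 h2 =>
    obtain ⟨c, hc⟩ := h1
    obtain ⟨d, hd⟩ := h2
    refine ⟨c + d, ?_⟩
    filter_upwards [Lp.coeFn_add ξ η, hc, hd] with ω h1 h2 h3
    rw [Finsupp.sum_add_index' (by simp) (by intros; simp [add_mul]), h1, Pi.add_apply, h2, h3]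
  | smul r ξ _ h1 =>
    obtain ⟨c, hc⟩ := h1
    refine ⟨r • c, ?_⟩
    filter_upwards [Lp.coeFn_smul r ξ, hc] with ω h1 h2
    rw [Finsupp.sum_smul_index' (by simp), h1, Pi.smul_apply, h2, Finsupp.smul_sum]
    refine Finset.sum_congr rfl fun l _ => ?_
    simp only [smul_mul_assoc, Complex.smul_re]

theorem hasGaussianLaw_finsupp_sum {a : (Fin 2 → ℤ) → Ω → ℂ} {P : Measure Ω}
    [IsProbabilityMeasure P] (ha : IsGaussianCoefficients a P) (c : halfLattice →₀ ℂ) :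
    HasGaussianLaw (fun ω => c.sum fun l z => (z * a l ω).re) P := by
  have hind : iIndepFun (fun (l : c.support) ω => (c l * a l ω).re) P := by
    have h := ha.iIndep.precomp (g := fun l : c.support => (l : halfLattice))
      Subtype.val_injective
    exact h.comp (fun l x => (c l * x).re) fun l => by fun_prop
  have := iIndepFun.hasGaussianLaw_fun_sum
    (fun l : c.support => hasGaussianLaw_re_mul ha (ne_zero_of_mem_halfLattice l.1.2) (c l)) hind
  simpa only [Finsupp.sum, ← Finset.sum_coe_sort c.support] using this

theorem integral_finsupp_sum {a : (Fin 2 → ℤ) → Ω → ℂ} {P : Measure Ω}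
    [IsProbabilityMeasure P] (ha : IsGaussianCoefficients a P) (c : halfLattice →₀ ℂ) :
    ∫ ω, c.sum (fun l z => (z * a l ω).re) ∂P = 0 := by
  simp only [Finsupp.sum]
  rw [integral_finsetSum _ fun l _ =>
    (hasGaussianLaw_re_mul ha (ne_zero_of_mem_halfLattice l.2) (c l)).integrable]
  exact Finset.sum_eq_zero fun l _ => integral_re_mul ha (ne_zero_of_mem_halfLattice l.2) (c l)

/-- On the span this is the law of a finite sum of independent Gaussians. The formula for the
characteristic function in terms of the `L²` norm is a closed condition, hence survives in the
closure. -/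
theorem hasLaw_of_mem_gaussianSpace {a : (Fin 2 → ℤ) → Ω → ℂ} {P : Measure Ω}
    [IsProbabilityMeasure P] (ha : IsGaussianCoefficients a P) {ξ : Lp ℝ 2 P}
    (hξ : ξ ∈ gaussianSpace a P) : HasLaw ξ (gaussianReal 0 (‖ξ‖₊ ^ 2)) P := by
  refine hasLaw_of_charFun_eq ?_
  intro t
  have hclosed : IsClosed {ξ : Lp ℝ 2 P | ∫ ω, Complex.exp (t * ξ ω * Complex.I) ∂P =
      Complex.exp (-(t ^ 2 * ‖ξ‖ ^ 2 / 2))} :=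
    isClosed_eq (continuous_integral_exp t) (by fun_prop)
  refine hclosed.closure_subset_iff.mpr ?_ hξ
  intro η hη
  obtain ⟨c, hc⟩ := exists_finsupp_of_mem_span ha hη
  exact charFun_eq_of_hasGaussianLaw ((hasGaussianLaw_finsupp_sum ha c).congr hc.symm)
    (by rw [integral_congr_ae hc, integral_finsupp_sum ha c]) t

/-- Orthogonal elements of a Gaussian space are independent. -/
theorem iIndepFun_of_mem_gaussianSpace {a : (Fin 2 → ℤ) → Ω → ℂ} {P : Measure Ω}
    [IsProbabilityMeasure P] (ha : IsGaussianCoefficients a P) {ι : Type*} [Fintype ι]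
    {ξ : ι → Lp ℝ 2 P} (hξ : ∀ i, ξ i ∈ gaussianSpace a P)
    (horth : ∀ i j, i ≠ j → inner ℝ (ξ i) (ξ j) = 0) :
    iIndepFun (fun i => (ξ i : Ω → ℝ)) P := by
  classical
  have hmean : ∀ i, ∫ ω, ξ i ω ∂P = 0 := fun i => by
    rw [(hasLaw_of_mem_gaussianSpace ha (hξ i)).integral_eq, integral_id_gaussianReal]
  refine HasGaussianLaw.iIndepFun_of_covariance_eq_zero ⟨?_⟩ fun i j hij => ?_
  · have hm : AEMeasurable (fun ω i => ξ i ω) P :=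
      aemeasurable_pi_lambda _ fun i => aemeasurable_Lp (ξ i)
    -- Joint Gaussianity: each linear functional of the vector lies again in the Gaussian space, so
    -- it is a centred Gaussian with variance its squared norm.
    refine isGaussian_of_map_eq_gaussianReal fun L => ⟨0, ‖∑ i, L (Pi.single i 1) • ξ i‖₊ ^ 2, ?_⟩
    rw [AEMeasurable.map_map_of_aemeasurable (by fun_prop) hm]
    have hlaw := hasLaw_of_mem_gaussianSpace ha
      (Submodule.sum_mem _ fun i (_ : i ∈ Finset.univ) =>
        Submodule.smul_mem _ (L (Pi.single i 1)) (hξ i))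
    rw [← hlaw.map_eq]
    refine Measure.map_congr ?_
    have h1 : ∀ᵐ ω ∂P, ∀ i, (L (Pi.single i 1) • ξ i) ω = L (Pi.single i 1) * ξ i ω := by
      rw [ae_all_iff]
      intro i
      filter_upwards [Lp.coeFn_smul (L (Pi.single i 1)) (ξ i)] with ω hω
      simp [hω]
    filter_upwards [Lp.coeFn_finsetSum Finset.univ fun i => L (Pi.single i 1) • ξ i, h1]
      with ω h2 h3
    rw [h2, Finset.sum_apply]
    simp only [h3, Function.comp]
    have h4 : L (fun i => ξ i ω) = ∑ i, ξ i ω • L (fun j => if i = j then 1 else 0) :=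
      LinearMap.pi_apply_eq_sum_univ (L : (ι → ℝ) →ₗ[ℝ] ℝ) _
    rw [h4]
    refine Finset.sum_congr rfl fun i _ => ?_
    have h5 : (fun j => if i = j then (1 : ℝ) else 0) = Pi.single i 1 := by
      funext j
      simp [Pi.single_apply, eq_comm]
    rw [smul_eq_mul, mul_comm, h5]
  · rw [covariance_eq_sub (Lp.memLp _) (Lp.memLp _), hmean, hmean]
    have := horth i j hij
    rw [inner_eq_integral_mul] at this
    simpa using this

end

/-! ### Conditioning a product of Hermite polynomials on one Gaussian variable. -/

section

variable {Ω : Type*} [MeasurableSpace Ω]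

/-- A signed measure on the line, given as the image of a density, is determined by its
characteristic function. -/
theorem integral_comp_mul_eq_zero_of_charFun {P : Measure Ω} {T D : Ω → ℝ} (hT : AEMeasurable T P)
    (hD : Integrable D P)
    (h : ∀ s : ℝ, ∫ ω, Complex.exp (s * T ω * Complex.I) * D ω ∂P = 0)
    {ψ : ℝ → ℝ} (hψ : Measurable ψ) (hψD : Integrable (fun ω => ψ (T ω) * D ω) P) :
    ∫ ω, ψ (T ω) * D ω ∂P = 0 := by
  -- The positive and negative parts of `D` define two finite positive measures. Their images under
  -- `T` have the same characteristic function, hence coincide.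
  set μ₁ : Measure Ω := P.withDensity fun ω => ENNReal.ofReal (D ω) with hμ₁
  set μ₂ : Measure Ω := P.withDensity fun ω => ENNReal.ofReal (-D ω) with hμ₂
  have hDm : AEMeasurable D P := hD.aestronglyMeasurable.aemeasurable
  have : IsFiniteMeasure μ₁ := isFiniteMeasure_withDensity_ofReal hD.2
  have : IsFiniteMeasure μ₂ := isFiniteMeasure_withDensity_ofReal hD.neg.2
  have hT₁ : AEMeasurable T μ₁ := hT.mono_ac (withDensity_absolutelyContinuous _ _)
  have hT₂ : AEMeasurable T μ₂ := hT.mono_ac (withDensity_absolutelyContinuous _ _)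
  have e₁ : ∀ {E : Type} [NormedAddCommGroup E] [NormedSpace ℝ E] (f : Ω → E),
      ∫ ω, f ω ∂μ₁ = ∫ ω, max (D ω) 0 • f ω ∂P := by
    intro E _ _ f
    rw [hμ₁, integral_withDensity_eq_integral_toReal_smul₀ hDm.ennreal_ofReal
      (Eventually.of_forall fun _ => ENNReal.ofReal_lt_top)]
    simp only [ENNReal.toReal_ofReal']
  have e₂ : ∀ {E : Type} [NormedAddCommGroup E] [NormedSpace ℝ E] (f : Ω → E),
      ∫ ω, f ω ∂μ₂ = ∫ ω, max (-D ω) 0 • f ω ∂P := by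
    intro E _ _ f
    rw [hμ₂, integral_withDensity_eq_integral_toReal_smul₀
      (show AEMeasurable (fun ω => ENNReal.ofReal (-D ω)) P from hDm.neg.ennreal_ofReal)
      (Eventually.of_forall fun _ => ENNReal.ofReal_lt_top)]
    simp only [ENNReal.toReal_ofReal']
  have hsplit : ∀ x : ℝ, max x 0 - max (-x) 0 = x := by
    intro x
    rcases le_total 0 x with hx | hx
    · rw [max_eq_left hx, max_eq_right (by linarith), sub_zero]
    · rw [max_eq_right hx, max_eq_left (by linarith)]; ring
  have hmap : μ₁.map T = μ₂.map T := by
    refine Measure.ext_of_charFun (funext fun s => ?_)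
    rw [charFun_apply_real, charFun_apply_real, integral_map hT₁ (by fun_prop),
      integral_map hT₂ (by fun_prop), e₁, e₂, ← sub_eq_zero]
    have hb : ∀ {d : Ω → ℝ}, Integrable d P →
        Integrable (fun ω => d ω • Complex.exp (s * T ω * Complex.I)) P := by
      intro d hd
      have hm : AEStronglyMeasurable (fun ω => Complex.exp (s * T ω * Complex.I)) P := by
        have h2 : Continuous fun x : ℝ => Complex.exp (s * x * Complex.I) := by fun_prop
        exact h2.comp_aestronglyMeasurable hT.aestronglyMeasurable
      refine ((integrable_complexOfReal hd).bdd_mul (c := 1) hm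
        (Eventually.of_forall fun ω => ?_)).congr (Eventually.of_forall fun ω => ?_)
      · rw [← Complex.ofReal_mul, Complex.norm_exp_ofReal_mul_I]
      · simp only [Complex.real_smul, mul_comm]
    rw [← integral_sub (hb hD.pos_part) (hb hD.neg_part), ← h s]
    refine integral_congr_ae (Eventually.of_forall fun ω => ?_)
    simp only []
    rw [← sub_smul, hsplit, Complex.real_smul, mul_comm]
  have hfin : ∫ x, ψ x ∂(μ₁.map T) = ∫ x, ψ x ∂(μ₂.map T) := by rw [hmap]
  rw [integral_map hT₁ hψ.aestronglyMeasurable, integral_map hT₂ hψ.aestronglyMeasurable,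
    e₁, e₂, ← sub_eq_zero] at hfin
  have hψm : AEStronglyMeasurable (fun ω => ψ (T ω)) P :=
    (hψ.comp_aemeasurable hT).aestronglyMeasurable
  have i₁ : Integrable (fun ω => max (D ω) 0 • ψ (T ω)) P := by
    refine hψD.mono (hD.pos_part.aestronglyMeasurable.smul hψm) (Eventually.of_forall fun ω => ?_)
    rw [norm_smul, norm_mul, mul_comm]
    gcongr
    rw [Real.norm_eq_abs, Real.norm_eq_abs, abs_of_nonneg (le_max_right _ _)]
    exact max_le (le_abs_self _) (abs_nonneg _)
  have i₂ : Integrable (fun ω => max (-D ω) 0 • ψ (T ω)) P := by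
    refine hψD.mono (hD.neg_part.aestronglyMeasurable.smul hψm) (Eventually.of_forall fun ω => ?_)
    rw [norm_smul, norm_mul, mul_comm]
    gcongr
    rw [Real.norm_eq_abs, Real.norm_eq_abs, abs_of_nonneg (le_max_right _ _)]
    exact max_le (neg_le_abs _) (abs_nonneg _)
  rw [← integral_sub i₁ i₂] at hfin
  rw [← hfin]
  refine integral_congr_ae (Eventually.of_forall fun ω => ?_)
  simp only []
  rw [← sub_smul, hsplit, smul_eq_mul, mul_comm]

/-- The norm of a standard Gaussian variable. -/
theorem norm_eq_one_of_hasLaw {P : Measure Ω} [IsProbabilityMeasure P] {ξ : Lp ℝ 2 P}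
    (h : HasLaw ξ (gaussianReal 0 1) P) : ‖ξ‖ = 1 := by
  have h1 := h.variance_eq
  rw [variance_id_gaussianReal, variance_of_integral_eq_zero h.aemeasurable
    (by rw [h.integral_eq, integral_id_gaussianReal]), ← norm_sq_eq_integral_sq] at h1
  have h2 : ‖ξ‖ ^ 2 = 1 := by simpa using h1
  nlinarith [norm_nonneg ξ]

theorem integral_eq_zero_of_mem_gaussianSpace {a : (Fin 2 → ℤ) → Ω → ℂ} {P : Measure Ω}
    [IsProbabilityMeasure P] (ha : IsGaussianCoefficients a P) {ξ : Lp ℝ 2 P}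
    (hξ : ξ ∈ gaussianSpace a P) : ∫ ω, ξ ω ∂P = 0 := by
  rw [(hasLaw_of_mem_gaussianSpace ha hξ).integral_eq, integral_id_gaussianReal]

/-- The Fourier transform of a product of Hermite polynomials in independent variables, tested
against a variable of the same Gaussian space. -/
theorem integral_exp_mul_prod_hermiteFun {a : (Fin 2 → ℤ) → Ω → ℂ} {P : Measure Ω}
    [IsProbabilityMeasure P] (ha : IsGaussianCoefficients a P) {T : Lp ℝ 2 P}
    (hT : T ∈ gaussianSpace a P) (hT1 : ‖T‖ = 1) {k : ℕ} (p : Fin k → ℕ) {ξ : Fin k → Lp ℝ 2 P}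
    (hξ : ∀ i, ξ i ∈ gaussianSpace a P) (hlaw : ∀ i, HasLaw (ξ i) (gaussianReal 0 1) P)
    (hind : iIndepFun (fun i => (ξ i : Ω → ℝ)) P) (s : ℝ) :
    ∫ ω, Complex.exp (s * T ω * Complex.I) * (∏ i, hermiteFun (p i) (ξ i ω) : ℝ) ∂P
      = (∏ i, inner ℝ T (ξ i) ^ p i : ℝ) * ((s * Complex.I) ^ (∑ i, p i) *
        Complex.exp (-s ^ 2 / 2)) := by
  set ρ : Fin k → ℝ := fun i => inner ℝ T (ξ i) with hρ
  -- The residual of `T` after projection onto the `ξ i`. It is orthogonal to them, hence `W` and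
  -- the `ξ i` are independent and the expectation of `exp(isT)` times the product factorises.
  set W : Lp ℝ 2 P := T - ∑ i, ρ i • ξ i with hW
  have hon : ∀ i j, inner ℝ (ξ i) (ξ j) = if i = j then (1 : ℝ) else 0 := by
    intro i j
    split_ifs with hij
    · rw [hij, real_inner_self_eq_norm_sq, norm_eq_one_of_hasLaw (hlaw j), one_pow]
    · rw [inner_eq_integral_mul, (hind.indepFun hij).integral_fun_mul_eq_mul_integral
        (Lp.aestronglyMeasurable _) (Lp.aestronglyMeasurable _),
        integral_eq_zero_of_mem_gaussianSpace ha (hξ i), zero_mul]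
  have hWA : W ∈ gaussianSpace a P :=
    Submodule.sub_mem _ hT (Submodule.sum_mem _ fun i _ => Submodule.smul_mem _ _ (hξ i))
  have hWξ : ∀ j, inner ℝ W (ξ j) = 0 := by
    intro j
    rw [hW, inner_sub_left, sum_inner]
    simp [real_inner_smul_left, hon, hρ]
  have hWn : ‖W‖ ^ 2 = 1 - ∑ i, ρ i ^ 2 := by
    rw [← real_inner_self_eq_norm_sq]
    nth_rewrite 2 [hW]
    rw [inner_sub_right, inner_sum]
    simp only [real_inner_smul_right, hWξ, mul_zero, Finset.sum_const_zero, sub_zero]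
    rw [hW, inner_sub_left, sum_inner, real_inner_self_eq_norm_sq, hT1, one_pow]
    simp only [real_inner_smul_left, hρ, pow_two]
    congr 1
    exact Finset.sum_congr rfl fun i _ => by rw [real_inner_comm]
  set X : Fin (k + 1) → Lp ℝ 2 P := Fin.cons W ξ with hX
  have hXA : ∀ i, X i ∈ gaussianSpace a P := Fin.cases hWA hξ
  have hXorth : ∀ i j, i ≠ j → inner ℝ (X i) (X j) = 0 := by
    refine Fin.cases (Fin.cases (fun h => absurd rfl h) fun j _ => hWξ j) fun i => Fin.cases
      (fun _ => by rw [real_inner_comm]; exact hWξ i) fun j hij => ?_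
    simp only [hX, Fin.cons_succ]
    rw [hon, if_neg fun h => hij (by rw [h])]
  have hXind := iIndepFun_of_mem_gaussianSpace ha hXA hXorth
  set f : Fin (k + 1) → ℝ → ℂ := Fin.cons (fun x => Complex.exp (s * x * Complex.I))
    (fun i x => Complex.exp ((s * ρ i : ℝ) * x * Complex.I) * hermiteFun (p i) x) with hf
  have hfc : ∀ i, Continuous (f i) := by
    refine Fin.cases ?_ fun i => ?_
    · simp only [hf, Fin.cons_zero]; fun_prop
    · simp only [hf, Fin.cons_succ]; fun_prop
  have hmain := hXind.integral_fun_prod_comp (f := f) (fun i => aemeasurable_Lp _)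
    fun i => (hfc i).aestronglyMeasurable
  have hlhs : ∫ ω, Complex.exp (s * T ω * Complex.I) * (∏ i, hermiteFun (p i) (ξ i ω) : ℝ) ∂P =
      ∫ ω, ∏ i, f i (X i ω) ∂P := by
    refine integral_congr_ae ?_
    have hsm : ∀ᵐ ω ∂P, ∀ i, (ρ i • ξ i) ω = ρ i * ξ i ω := by
      rw [ae_all_iff]
      intro i
      filter_upwards [Lp.coeFn_smul (ρ i) (ξ i)] with ω hω
      simp [hω]
    filter_upwards [Lp.coeFn_sub T (∑ i, ρ i • ξ i),
      Lp.coeFn_finsetSum Finset.univ fun i => ρ i • ξ i, hsm] with ω h1 h2 h3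
    rw [Fin.prod_univ_succ]
    simp only [hf, hX, Fin.cons_zero, Fin.cons_succ]
    rw [Finset.prod_mul_distrib, ← mul_assoc, ← Complex.exp_sum, ← Complex.exp_add,
      ← Complex.ofReal_prod]
    congr 2
    rw [← hW] at h1
    rw [h1, Pi.sub_apply, h2, Finset.sum_apply]
    simp only [h3]
    push_cast
    simp only [Finset.mul_sum, mul_sub, sub_mul, Finset.sum_mul]
    rw [sub_add_eq_add_sub, eq_sub_iff_add_eq]
    congr 1
    exact Finset.sum_congr rfl fun i _ => by ring
  have hWint : ∫ ω, Complex.exp (s * W ω * Complex.I) ∂P =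
      Complex.exp (-(s ^ 2 * ‖W‖ ^ 2 / 2)) := by
    have h := hasLaw_of_mem_gaussianSpace ha hWA
    have h2 := charFun_gaussianReal (μ := 0) (v := ‖W‖₊ ^ 2) s
    rw [← h.map_eq, charFun_apply_real, integral_map h.aemeasurable (by fun_prop)] at h2
    rw [h2]
    congr 1
    simp
    ring
  have hξint : ∀ i, ∫ ω, Complex.exp ((s * ρ i : ℝ) * ξ i ω * Complex.I) *
      hermiteFun (p i) (ξ i ω) ∂P =
      ((s * ρ i : ℝ) * Complex.I) ^ p i * Complex.exp (-((s * ρ i : ℝ) : ℂ) ^ 2 / 2) := by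
    intro i
    rw [← integral_exp_mul_hermiteFun]
    have h := (hlaw i).integral_comp (f := fun x : ℝ => Complex.exp ((s * ρ i : ℝ) * x * Complex.I) *
      hermiteFun (p i) x) (by fun_prop)
    exact h
  rw [hlhs, hmain, Fin.prod_univ_succ]
  simp only [hf, hX, Fin.cons_zero, Fin.cons_succ]
  rw [hWint]
  simp only [hξint]
  rw [Finset.prod_mul_distrib, ← Complex.exp_sum, ← Finset.prod_pow_eq_pow_sum]
  have e1 : ∏ i, (((s * ρ i : ℝ) : ℂ) * Complex.I) ^ p i =
      ((∏ i, ρ i ^ p i : ℝ) : ℂ) * ∏ i, ((s : ℂ) * Complex.I) ^ p i := by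
    push_cast
    rw [← Finset.prod_mul_distrib]
    refine Finset.prod_congr rfl fun i _ => ?_
    rw [← mul_pow]
    ring
  -- The Gaussian factors recombine because `‖W‖² + ∑ ρ i ² = ‖T‖² = 1`.
  have e2 : Complex.exp (-(s ^ 2 * ‖W‖ ^ 2 / 2)) *
      Complex.exp (∑ i, -((s * ρ i : ℝ) : ℂ) ^ 2 / 2) = Complex.exp (-s ^ 2 / 2) := by
    rw [← Complex.exp_add]
    congr 1
    have : (‖W‖ : ℂ) ^ 2 = 1 - ∑ i, (ρ i : ℂ) ^ 2 := by exact_mod_cast congrArg Complex.ofReal hWn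
    rw [this, mul_sub, Finset.mul_sum, sub_div, Finset.sum_div, neg_sub, sub_add_eq_add_sub,
      ← Finset.sum_add_distrib, Finset.sum_eq_zero]
    · ring
    · intro i _
      push_cast
      ring
  rw [e1, ← e2]
  ring

/-- The conditional expectation, given a standard variable `T` of the Gaussian space, of a product
of Hermite polynomials in independent variables is a multiple of a Hermite polynomial in `T`. -/
theorem integral_comp_mul_prod_hermiteFun {a : (Fin 2 → ℤ) → Ω → ℂ} {P : Measure Ω}
    [IsProbabilityMeasure P] (ha : IsGaussianCoefficients a P) {T : Lp ℝ 2 P}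
    (hT : T ∈ gaussianSpace a P) (hTlaw : HasLaw T (gaussianReal 0 1) P) {k : ℕ} (p : Fin k → ℕ)
    {ξ : Fin k → Lp ℝ 2 P}
    (hξ : ∀ i, ξ i ∈ gaussianSpace a P) (hlaw : ∀ i, HasLaw (ξ i) (gaussianReal 0 1) P)
    (hind : iIndepFun (fun i => (ξ i : Ω → ℝ)) P) {F : Ω → ℝ} (hF : Integrable F P)
    (hFeq : ∀ᵐ ω ∂P, F ω = ∏ i, hermiteFun (p i) (ξ i ω)) {ψ : ℝ → ℝ} (hψ : Measurable ψ)
    (hψF : Integrable (fun ω => ψ (T ω) * F ω) P)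
    (hψH : Integrable (fun x => ψ x * hermiteFun (∑ i, p i) x) (gaussianReal 0 1)) :
    ∫ ω, ψ (T ω) * F ω ∂P = (∏ i, inner ℝ T (ξ i) ^ p i) *
      ∫ x, ψ x * hermiteFun (∑ i, p i) x ∂gaussianReal 0 1 := by
  set c : ℝ := ∏ i, inner ℝ T (ξ i) ^ p i with hc
  set q := ∑ i, p i with hq
  have hTm : AEMeasurable T P := aemeasurable_Lp T
  have hH : Integrable (fun ω => hermiteFun q (T ω)) P := by
    have h := integrable_hermiteFun q
    rw [← hTlaw.map_eq] at h
    exact h.comp_aemeasurable hTm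
  have hψH' : Integrable (fun ω => ψ (T ω) * hermiteFun q (T ω)) P := by
    rw [← hTlaw.map_eq] at hψH
    exact hψH.comp_aemeasurable hTm
  have hb : ∀ (s : ℝ) {d : Ω → ℝ}, Integrable d P →
      Integrable (fun ω => Complex.exp (s * T ω * Complex.I) * d ω) P := by
    intro s d hd
    have hm : AEStronglyMeasurable (fun ω => Complex.exp (s * T ω * Complex.I)) P := by
      have h2 : Continuous fun x : ℝ => Complex.exp (s * x * Complex.I) := by fun_prop
      exact h2.comp_aestronglyMeasurable hTm.aestronglyMeasurable
    refine (integrable_complexOfReal hd).bdd_mul (c := 1) hm (Eventually.of_forall fun ω => ?_)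
    rw [← Complex.ofReal_mul, Complex.norm_exp_ofReal_mul_I]
  -- Tested against `exp(isT)`, both `F` and `c H_q(T)` give `c (is)^q exp(-s²/2)`, so the
  -- difference has zero Fourier transform along `T`.
  have hzero : ∫ ω, ψ (T ω) * (F ω - c * hermiteFun q (T ω)) ∂P = 0 := by
    refine integral_comp_mul_eq_zero_of_charFun hTm (hF.sub (hH.const_mul c)) ?_ hψ ?_
    · intro s
      have e1 : ∫ ω, Complex.exp (s * T ω * Complex.I) * F ω ∂P =
          c * ((s * Complex.I) ^ q * Complex.exp (-s ^ 2 / 2)) := by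
        rw [← integral_exp_mul_prod_hermiteFun ha hT (norm_eq_one_of_hasLaw hTlaw) p hξ hlaw hind s]
        refine integral_congr_ae ?_
        filter_upwards [hFeq] with ω hω
        rw [hω]
      have e2 : ∫ ω, Complex.exp (s * T ω * Complex.I) * hermiteFun q (T ω) ∂P =
          (s * Complex.I) ^ q * Complex.exp (-s ^ 2 / 2) := by
        rw [← integral_exp_mul_hermiteFun]
        exact hTlaw.integral_comp (f := fun x : ℝ => Complex.exp (s * x * Complex.I) *
          hermiteFun q x) (by fun_prop)
      have e3 : ∀ ω, Complex.exp (s * T ω * Complex.I) * ((F ω - c * hermiteFun q (T ω) : ℝ) : ℂ) =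
          Complex.exp (s * T ω * Complex.I) * F ω -
            c * (Complex.exp (s * T ω * Complex.I) * hermiteFun q (T ω)) := by
        intro ω; push_cast; ring
      refine (integral_congr_ae (Eventually.of_forall e3)).trans ?_
      rw [integral_sub (hb s hF) ((hb s hH).const_mul _), integral_const_mul, e1, e2, sub_self]
    · refine (hψF.sub (hψH'.const_mul c)).congr (Eventually.of_forall fun ω => ?_)
      change ψ (T ω) * F ω - c * (ψ (T ω) * hermiteFun q (T ω)) =
        ψ (T ω) * (F ω - c * hermiteFun q (T ω))
      ring
  have e4 : ∀ ω, ψ (T ω) * (F ω - c * hermiteFun q (T ω)) =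
      ψ (T ω) * F ω - c * (ψ (T ω) * hermiteFun q (T ω)) := by intro ω; ring
  simp only [e4] at hzero
  rw [integral_sub hψF (hψH'.const_mul c), integral_const_mul, sub_eq_zero] at hzero
  rw [hzero]
  congr 1
  exact hTlaw.integral_comp (f := fun x => ψ x * hermiteFun q x) hψH.aestronglyMeasurable

end

section

variable {Ω : Type*} [MeasurableSpace Ω]

/-! ### Small balls for a bivariate Gaussian vector -/

theorem integral_deltaApprox {ε : ℝ} (hε : 0 < ε) : ∫ x, deltaApprox ε x = 1 := by
  unfold deltaApprox
  rw [integral_indicator measurableSet_Ioo, setIntegral_const, smul_eq_mul, Real.volume_real_Ioo_of_le (by linarith)]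
  field_simp
  ring

theorem integrable_deltaApprox {ε : ℝ} : Integrable (deltaApprox ε) :=
  (integrableOn_const (by simp)).integrable_indicator measurableSet_Ioo

theorem deltaApprox_eq_zero {ε x : ℝ} (h : ε ≤ |x|) : deltaApprox ε x = 0 :=
  Set.indicator_of_notMem (fun hx => absurd (abs_lt.mpr (Set.mem_Ioo.mp hx)) (not_lt.mpr h)) _

theorem integrable_deltaApprox_comp {α : Type*} [MeasurableSpace α] {μ : Measure α}
    [IsFiniteMeasure μ] {ε : ℝ} (hε : 0 < ε) {f : α → ℝ} (hf : AEMeasurable f μ) :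
    Integrable (fun x => deltaApprox ε (f x)) μ :=
  Integrable.of_bound ((measurable_deltaApprox ε).comp_aemeasurable hf).aestronglyMeasurable
    (2 * ε)⁻¹ (Eventually.of_forall fun _ => norm_deltaApprox_le hε _)

theorem integral_deltaApprox_add_eq {v : ℝ≥0} (hv : v ≠ 0) (m δ : ℝ) :
    ∫ w, deltaApprox δ (m + w) ∂gaussianReal 0 v =
      ∫ y, gaussianPDFReal 0 v (y - m) * deltaApprox δ y := by
  rw [integral_gaussianReal_eq_integral_smul hv,
    ← integral_add_left_eq_self (fun y => gaussianPDFReal 0 v (y - m) * deltaApprox δ y) m]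
  simp

theorem integrable_gaussianPDFReal_mul_deltaApprox (v : ℝ≥0) (m δ : ℝ) (hδ : 0 < δ) :
    Integrable fun y => gaussianPDFReal 0 v (y - m) * deltaApprox δ y := by
  have h : Integrable fun y => gaussianPDFReal 0 v (y - m) :=
    (integrable_gaussianPDFReal 0 v).comp_sub_right m
  exact h.mul_bdd (c := (2 * δ)⁻¹) (measurable_deltaApprox δ).aestronglyMeasurable
    (Eventually.of_forall fun x => norm_deltaApprox_le hδ x)

theorem integral_deltaApprox_add_le {v : ℝ≥0} (hv : v ≠ 0) (m : ℝ) {δ : ℝ} (hδ : 0 < δ) :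
    ∫ w, deltaApprox δ (m + w) ∂gaussianReal 0 v ≤ (√(2 * Real.pi * v))⁻¹ := by
  rw [integral_deltaApprox_add_eq hv]
  calc _ ≤ ∫ y, (√(2 * Real.pi * v))⁻¹ * deltaApprox δ y := by
        refine integral_mono (integrable_gaussianPDFReal_mul_deltaApprox v m δ hδ)
          (integrable_deltaApprox.const_mul _) fun y => ?_
        refine mul_le_mul_of_nonneg_right ?_ (deltaApprox_nonneg hδ y)
        rw [gaussianPDFReal]
        refine mul_le_of_le_one_right (by positivity) (Real.exp_le_one_iff.mpr ?_)
        rw [neg_div]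
        exact neg_nonpos.mpr (by positivity)
    _ = _ := by rw [integral_const_mul, integral_deltaApprox hδ, mul_one]

/-- Where `deltaApprox δ` does not vanish, the argument of the density is at distance at most `|m| +
δ` from the centre. -/
theorem le_integral_deltaApprox_add {v : ℝ≥0} (hv : v ≠ 0) (m : ℝ) {δ : ℝ} (hδ : 0 < δ) :
    (√(2 * Real.pi * v))⁻¹ * Real.exp (-(|m| + δ) ^ 2 / (2 * v)) ≤
      ∫ w, deltaApprox δ (m + w) ∂gaussianReal 0 v := by
  rw [integral_deltaApprox_add_eq hv]
  calc _ = ∫ y, (√(2 * Real.pi * v))⁻¹ * Real.exp (-(|m| + δ) ^ 2 / (2 * v)) * deltaApprox δ y := by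
        rw [integral_const_mul, integral_deltaApprox hδ, mul_one]
    _ ≤ _ := by
        refine integral_mono (integrable_deltaApprox.const_mul _)
          (integrable_gaussianPDFReal_mul_deltaApprox v m δ hδ) fun y => ?_
        by_cases hy : δ ≤ |y|
        · simp [deltaApprox_eq_zero hy]
        refine mul_le_mul_of_nonneg_right ?_ (deltaApprox_nonneg hδ y)
        rw [gaussianPDFReal]
        push Not at hy
        have h1 : |y - m| ≤ |m| + δ := (abs_sub _ _).trans (by linarith)
        have h2 : (y - m - 0) ^ 2 ≤ (|m| + δ) ^ 2 := by
          rw [sub_zero, ← sq_abs (y - m)]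
          exact pow_le_pow_left₀ (abs_nonneg _) h1 2
        gcongr

/-- The density at the origin of a standard Gaussian vector with correlation `√(1 - v)`. -/
def originDensity (v : ℝ) : ℝ := (2 * Real.pi)⁻¹ * (1 / √v)

theorem inv_sqrt_mul_inv_sqrt (v : ℝ) :
    (√(2 * Real.pi * v))⁻¹ * (√(2 * Real.pi * (1 : ℝ≥0)))⁻¹ = originDensity v := by
  have hp : 0 ≤ 2 * Real.pi := by positivity
  rw [Real.sqrt_mul hp, NNReal.coe_one, mul_one, originDensity, mul_inv, mul_right_comm, ← mul_inv,
    Real.mul_self_sqrt hp, one_div]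

/-- Decompose `Y = ρX + W` with `W` independent of `X` and of variance `1 - ρ²`, and integrate over
`W` before `X`. The upper bound is uniform in `ε` and `δ`, and the lower bound tends to it. -/
theorem integral_deltaApprox_mul_deltaApprox_bounds {a : (Fin 2 → ℤ) → Ω → ℂ} {P : Measure Ω}
    [IsProbabilityMeasure P] (ha : IsGaussianCoefficients a P) {X Y : Lp ℝ 2 P}
    (hX : X ∈ gaussianSpace a P) (hY : Y ∈ gaussianSpace a P) (hX1 : ‖X‖ = 1) (hY1 : ‖Y‖ = 1)
    (hXY : inner ℝ X Y ^ 2 < 1) {ε δ : ℝ} (hε : 0 < ε) (hδ : 0 < δ) :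
    ∫ ω, deltaApprox ε (X ω) * deltaApprox δ (Y ω) ∂P ≤ originDensity (1 - inner ℝ X Y ^ 2) ∧
    originDensity (1 - inner ℝ X Y ^ 2) *
      Real.exp (-((ε + δ) ^ 2 / (2 * (1 - inner ℝ X Y ^ 2)) + (ε + δ) ^ 2 / 2)) ≤
      ∫ ω, deltaApprox ε (X ω) * deltaApprox δ (Y ω) ∂P := by
  set ρ : ℝ := inner ℝ X Y with hρ
  set W : Lp ℝ 2 P := Y - ρ • X with hW
  have hWA : W ∈ gaussianSpace a P := Submodule.sub_mem _ hY (Submodule.smul_mem _ _ hX)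
  have hXW : inner ℝ X W = 0 := by
    rw [hW, inner_sub_right, real_inner_smul_right, real_inner_self_eq_norm_sq, hX1, ← hρ]
    ring
  have hWn : ‖W‖ ^ 2 = 1 - ρ ^ 2 := by
    rw [← real_inner_self_eq_norm_sq]
    nth_rewrite 1 [hW]
    rw [inner_sub_left, real_inner_smul_left, hXW, hW, inner_sub_right, real_inner_smul_right,
      real_inner_self_eq_norm_sq, hY1, real_inner_comm, ← hρ]
    ring
  set v : ℝ≥0 := ‖W‖₊ ^ 2 with hv
  have hvr : (v : ℝ) = 1 - ρ ^ 2 := by rw [← hWn]; simp [hv]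
  have hv0 : v ≠ 0 := by
    intro h
    rw [h, NNReal.coe_zero] at hvr
    linarith
  have hind : IndepFun X W P := by
    have h := iIndepFun_of_mem_gaussianSpace ha (ξ := ![X, W])
      (by intro i; fin_cases i <;> simp [hX, hWA])
      (by
        intro i j hij
        fin_cases i <;> fin_cases j <;> simp_all [real_inner_comm])
    exact h.indepFun (i := 0) (j := 1) (by simp)
  have hXlaw : P.map X = gaussianReal 0 1 := by
    have h := (hasLaw_of_mem_gaussianSpace ha hX).map_eq
    have h1 : ‖X‖₊ = 1 := by ext; simp [hX1]
    rwa [h1, one_pow] at h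
  have hWlaw : P.map W = gaussianReal 0 v := (hasLaw_of_mem_gaussianSpace ha hWA).map_eq
  have hjoint : P.map (fun ω => (X ω, W ω)) = (gaussianReal 0 1).prod (gaussianReal 0 v) := by
    rw [(indepFun_iff_map_prod_eq_prod_map_map (aemeasurable_Lp X) (aemeasurable_Lp W)).mp hind,
      hXlaw, hWlaw]
  have hgm : Measurable fun z : ℝ × ℝ => deltaApprox ε z.1 * deltaApprox δ (ρ * z.1 + z.2) :=
    ((measurable_deltaApprox ε).comp measurable_fst).mul
      ((measurable_deltaApprox δ).comp (by fun_prop))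
  have hgi : Integrable (fun z : ℝ × ℝ => deltaApprox ε z.1 * deltaApprox δ (ρ * z.1 + z.2))
      ((gaussianReal 0 1).prod (gaussianReal 0 v)) := by
    refine Integrable.of_bound hgm.aestronglyMeasurable ((2 * ε)⁻¹ * (2 * δ)⁻¹)
      (Eventually.of_forall fun z => ?_)
    rw [norm_mul]
    exact mul_le_mul (norm_deltaApprox_le hε _) (norm_deltaApprox_le hδ _) (norm_nonneg _)
      (by positivity)
  have hE : ∫ ω, deltaApprox ε (X ω) * deltaApprox δ (Y ω) ∂P =
      ∫ x, deltaApprox ε x * ∫ w, deltaApprox δ (ρ * x + w) ∂gaussianReal 0 v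
        ∂gaussianReal 0 1 := by
    have h1 : ∫ ω, deltaApprox ε (X ω) * deltaApprox δ (Y ω) ∂P =
        ∫ ω, (fun z : ℝ × ℝ => deltaApprox ε z.1 * deltaApprox δ (ρ * z.1 + z.2)) (X ω, W ω) ∂P := by
      refine integral_congr_ae ?_
      filter_upwards [Lp.coeFn_sub Y (ρ • X), Lp.coeFn_smul ρ X] with ω h2 h3
      rw [hW, h2, Pi.sub_apply, h3, Pi.smul_apply, smul_eq_mul, add_sub_cancel]
    rw [h1, ← integral_map ((aemeasurable_Lp X).prodMk (aemeasurable_Lp W))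
      hgm.aestronglyMeasurable, hjoint, integral_prod _ hgi]
    simp only [integral_const_mul]
  have hinner : Integrable (fun x => deltaApprox ε x *
      ∫ w, deltaApprox δ (ρ * x + w) ∂gaussianReal 0 v) (gaussianReal 0 1) := by
    have := hgi.integral_prod_left
    simpa only [integral_const_mul] using this
  have hφi : Integrable (deltaApprox ε) (gaussianReal 0 1) :=
    integrable_deltaApprox_comp hε aemeasurable_id
  have hup := integral_deltaApprox_add_le (v := 1) one_ne_zero 0 hε
  have hlow := le_integral_deltaApprox_add (v := 1) one_ne_zero 0 hε
  simp only [zero_add, abs_zero, NNReal.coe_one, mul_one] at hup hlow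
  rw [hE, ← hvr, ← inv_sqrt_mul_inv_sqrt]
  simp only [NNReal.coe_one, mul_one]
  refine ⟨?_, ?_⟩
  · calc _ ≤ ∫ x, (√(2 * Real.pi * v))⁻¹ * deltaApprox ε x ∂gaussianReal 0 1 := by
          refine integral_mono hinner (hφi.const_mul _) fun x => ?_
          rw [mul_comm]
          exact mul_le_mul_of_nonneg_right (integral_deltaApprox_add_le hv0 _ hδ)
            (deltaApprox_nonneg hε x)
      _ ≤ _ := by
          rw [integral_const_mul]
          gcongr
  · calc _ = ((√(2 * Real.pi * v))⁻¹ * Real.exp (-(ε + δ) ^ 2 / (2 * v))) *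
            ((√(2 * Real.pi))⁻¹ * Real.exp (-(ε + δ) ^ 2 / 2)) := by
          rw [neg_add, Real.exp_add, neg_div, neg_div]
          ring
      -- The exponent `ε²` is weakened to `(ε + δ)²`, so that the lower bound depends on `ε + δ`
      -- alone.
      _ ≤ ((√(2 * Real.pi * v))⁻¹ * Real.exp (-(ε + δ) ^ 2 / (2 * v))) *
            ∫ x, deltaApprox ε x ∂gaussianReal 0 1 := by
          gcongr
          refine le_trans ?_ hlow
          gcongr
          linarith
      _ = ∫ x, ((√(2 * Real.pi * v))⁻¹ * Real.exp (-(ε + δ) ^ 2 / (2 * v))) * deltaApprox ε x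
            ∂gaussianReal 0 1 := (integral_const_mul _ _).symm
      _ ≤ _ := by
          refine integral_mono (hφi.const_mul _) hinner fun x => ?_
          by_cases hx : ε ≤ |x|
          · simp [deltaApprox_eq_zero hx]
          simp only []
          rw [mul_comm]
          refine mul_le_mul_of_nonneg_left (le_trans ?_ (le_integral_deltaApprox_add hv0 _ hδ))
            (deltaApprox_nonneg hε x)
          gcongr
          push Not at hx
          rw [abs_mul]
          have hρ1 : |ρ| ≤ 1 := abs_le_one_iff_mul_self_le_one.mpr (by nlinarith)
          calc |ρ| * |x| ≤ 1 * |x| := by gcongr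
            _ ≤ ε := by linarith

end

section

variable {Ω : Type*}

/-! ### The wave as an element of the Gaussian space -/

theorem wave_eq_sum (a : (Fin 2 → ℤ) → Ω → ℂ) (n : ℕ) (x : Torus) (ω : Ω) :
    wave a n x ω = ∑ l ∈ latticePoints n,
      (√(latticeCount n))⁻¹ * (UnitAddTorus.mFourier l x * a l ω).re := by
  unfold wave
  rw [← Complex.ofReal_inv, Complex.re_ofReal_mul, Complex.re_sum, Finset.mul_sum]
  simp only [mul_comm (a _ ω)]

variable [MeasurableSpace Ω] {a : (Fin 2 → ℤ) → Ω → ℂ} {P : Measure Ω}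

theorem measurable_uncurry_wave (ha : IsGaussianCoefficients a P) {n : ℕ} (hn : 0 < n) :
    Measurable fun z : Torus × Ω => wave a n z.1 z.2 := by
  simp only [wave_eq_sum]
  refine Finset.measurable_sum _ fun l hl => ?_
  have h1 := ha.measurable l (ne_zero_of_mem_latticePoints hn hl)
  have h2 := (continuous_mFourier l).measurable
  have h3 : Measurable fun z : Torus × Ω => UnitAddTorus.mFourier l z.1 * a l z.2 :=
    (h2.comp measurable_fst).mul (h1.comp measurable_snd)
  exact (Complex.measurable_re.comp h3).const_mul _

/-- Independence is available only on `halfLattice`; conjugation moves any coefficient there without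
changing the real part. -/
theorem exists_halfLattice_re_mul_eq (ha : IsGaussianCoefficients a P) {l : Fin 2 → ℤ}
    (hl : l ≠ 0) (z : ℂ) : ∃ (l' : halfLattice) (z' : ℂ), ((l' : Fin 2 → ℤ) = l ∨ (l' : Fin 2 → ℤ) = -l) ∧
      (fun ω => (z * a l ω).re) =ᵐ[P] fun ω => (z' * a l' ω).re := by
  rcases mem_or_neg_mem_halfLattice hl with h | h
  · exact ⟨⟨l, h⟩, z, Or.inl rfl, EventuallyEq.rfl⟩
  · refine ⟨⟨-l, h⟩, conj z, Or.inr rfl, ?_⟩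
    filter_upwards [ha.conj_eq l hl] with ω hω
    rw [← hω, ← map_mul, Complex.conj_re]

theorem integral_re_mul_mul_re_mul (ha : IsGaussianCoefficients a P) {l : Fin 2 → ℤ} (hl : l ≠ 0)
    (z w : ℂ) : ∫ ω, (z * a l ω).re * (w * a l ω).re ∂P = (z * conj w).re / 2 := by
  have h1 : HasGaussianLaw (fun ω => (a l ω).re) P := (ha.hasLaw_re l hl).hasGaussianLaw
  have h2 : HasGaussianLaw (fun ω => (a l ω).im) P := (ha.hasLaw_im l hl).hasGaussianLaw
  have hsq : ∀ {X : Ω → ℝ}, HasLaw X (gaussianReal 0 (1 / 2)) P → ∫ ω, X ω ^ 2 ∂P = 1 / 2 := by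
    intro X hX
    have h := hX.variance_eq
    rw [variance_id_gaussianReal, variance_of_integral_eq_zero hX.aemeasurable
      (by rw [hX.integral_eq, integral_id_gaussianReal])] at h
    simpa using h
  have hcross : ∫ ω, (a l ω).re * (a l ω).im ∂P = 0 := by
    rw [(ha.indep_re_im l hl).integral_fun_mul_eq_mul_integral
      h1.aemeasurable.aestronglyMeasurable h2.aemeasurable.aestronglyMeasurable,
      (ha.hasLaw_re l hl).integral_eq, integral_id_gaussianReal, zero_mul]
  have e : ∀ ω, (z * a l ω).re * (w * a l ω).re = z.re * w.re * (a l ω).re ^ 2 +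
      z.im * w.im * (a l ω).im ^ 2 - (z.re * w.im + z.im * w.re) * ((a l ω).re * (a l ω).im) := by
    intro ω
    simp only [Complex.mul_re]
    ring
  simp only [e]
  have i1 : Integrable (fun ω => z.re * w.re * (a l ω).re ^ 2) P := h1.memLp_two.integrable_sq.const_mul (z.re * w.re)
  have i2 : Integrable (fun ω => z.im * w.im * (a l ω).im ^ 2) P := h2.memLp_two.integrable_sq.const_mul (z.im * w.im)
  have i12 : Integrable (fun ω => z.re * w.re * (a l ω).re ^ 2 + z.im * w.im * (a l ω).im ^ 2) P :=
    i1.add i2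
  have i3 : Integrable (fun ω => (z.re * w.im + z.im * w.re) * ((a l ω).re * (a l ω).im)) P :=
    (h1.memLp_two.integrable_mul h2.memLp_two).const_mul _
  rw [integral_sub i12 i3, integral_add i1 i2, integral_const_mul, integral_const_mul,
    integral_const_mul, hcross, hsq (ha.hasLaw_re l hl), hsq (ha.hasLaw_im l hl)]
  simp [Complex.mul_re]
  ring

theorem integral_re_mul_mul_re_mul_neg (ha : IsGaussianCoefficients a P) {l : Fin 2 → ℤ}
    (hl : l ≠ 0) (z w : ℂ) : ∫ ω, (z * a l ω).re * (w * a (-l) ω).re ∂P = (z * w).re / 2 := by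
  have h := integral_re_mul_mul_re_mul ha hl z (conj w)
  rw [Complex.conj_conj] at h
  rw [← h]
  refine integral_congr_ae ?_
  filter_upwards [ha.conj_eq l hl] with ω hω
  rw [← hω]
  congr 1
  rw [← Complex.conj_re]
  simp

variable [IsProbabilityMeasure P]

theorem memLp_re_mul (ha : IsGaussianCoefficients a P) {l : Fin 2 → ℤ} (hl : l ≠ 0) (z : ℂ) :
    MemLp (fun ω => (z * a l ω).re) 2 P := (hasGaussianLaw_re_mul ha hl z).memLp_two

theorem memLp_wave (ha : IsGaussianCoefficients a P) {n : ℕ} (hn : 0 < n) (x : Torus) :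
    MemLp (wave a n x) 2 P := by
  have : wave a n x = fun ω => ∑ l ∈ latticePoints n,
      (√(latticeCount n))⁻¹ * (UnitAddTorus.mFourier l x * a l ω).re :=
    funext fun ω => wave_eq_sum a n x ω
  rw [this]
  exact memLp_finsetSum _ fun l hl =>
    (memLp_re_mul ha (ne_zero_of_mem_latticePoints hn hl) _).const_mul _

/-- The value of the wave at a point, as an element of `L²`. -/
def waveLp (ha : IsGaussianCoefficients a P) {n : ℕ} (hn : 0 < n) (x : Torus) : Lp ℝ 2 P :=
  (memLp_wave ha hn x).toLp _

theorem coeFn_waveLp (ha : IsGaussianCoefficients a P) {n : ℕ} (hn : 0 < n) (x : Torus) :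
    waveLp ha hn x =ᵐ[P] wave a n x := MemLp.coeFn_toLp _

theorem toLp_re_mul_mem_gaussianSpace (ha : IsGaussianCoefficients a P) {l : Fin 2 → ℤ}
    (hl : l ≠ 0) (z : ℂ) : (memLp_re_mul ha hl z).toLp _ ∈ gaussianSpace a P := by
  -- The coefficient is `z / 2` because the generator with coefficient `z` is twice the real part of
  -- `z a_l`.
  refine Submodule.le_topologicalClosure _ (Submodule.subset_span ⟨l, z / 2, hl, ?_⟩)
  filter_upwards [(memLp_re_mul ha hl z).coeFn_toLp, ha.conj_eq l hl] with ω h1 h2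
  rw [h1, ← h2, ← map_mul, Complex.add_conj, div_mul_eq_mul_div,
    ← Complex.ofReal_ofNat, Complex.div_ofReal_re, mul_div_cancel₀ _ two_ne_zero]

theorem waveLp_mem_gaussianSpace (ha : IsGaussianCoefficients a P) {n : ℕ} (hn : 0 < n)
    (x : Torus) : waveLp ha hn x ∈ gaussianSpace a P := by
  have h : waveLp ha hn x = ∑ l ∈ (latticePoints n).attach, (√(latticeCount n))⁻¹ •
      (memLp_re_mul ha (ne_zero_of_mem_latticePoints hn l.2) (UnitAddTorus.mFourier l.1 x)).toLp _ := by
    apply Lp.ext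
    have h1 : ∀ᵐ ω ∂P, ∀ l : latticePoints n, ((√(latticeCount n))⁻¹ •
        (memLp_re_mul ha (ne_zero_of_mem_latticePoints hn l.2)
          (UnitAddTorus.mFourier l.1 x)).toLp _) ω =
        (√(latticeCount n))⁻¹ * (UnitAddTorus.mFourier l.1 x * a l ω).re := by
      rw [ae_all_iff]
      intro l
      filter_upwards [Lp.coeFn_smul (√(latticeCount n))⁻¹
        ((memLp_re_mul ha (ne_zero_of_mem_latticePoints hn l.2)
          (UnitAddTorus.mFourier l.1 x)).toLp _),
        (memLp_re_mul ha (ne_zero_of_mem_latticePoints hn l.2)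
          (UnitAddTorus.mFourier l.1 x)).coeFn_toLp] with ω h2 h3
      rw [h2, Pi.smul_apply, h3, smul_eq_mul]
    filter_upwards [coeFn_waveLp ha hn x, h1, Lp.coeFn_finsetSum (latticePoints n).attach
      fun l => (√(latticeCount n))⁻¹ •
        (memLp_re_mul ha (ne_zero_of_mem_latticePoints hn l.2)
          (UnitAddTorus.mFourier l.1 x)).toLp _] with ω h2 h3 h4
    rw [h2, h4, Finset.sum_apply, wave_eq_sum, ← Finset.sum_attach]
    exact Finset.sum_congr rfl fun l _ => (h3 l).symm
  rw [h]
  exact Submodule.sum_mem _ fun l _ => Submodule.smul_mem _ _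
    (toLp_re_mul_mem_gaussianSpace ha (ne_zero_of_mem_latticePoints hn l.2) _)

/-! ### The covariance of the wave -/

theorem integral_re_mul_mul_re_mul_of_ne (ha : IsGaussianCoefficients a P) {l m : Fin 2 → ℤ}
    (hl : l ≠ 0) (hm : m ≠ 0) (h1 : l ≠ m) (h2 : l ≠ -m) (z w : ℂ) :
    ∫ ω, (z * a l ω).re * (w * a m ω).re ∂P = 0 := by
  obtain ⟨l', z', hl', ez⟩ := exists_halfLattice_re_mul_eq ha hl z
  obtain ⟨m', w', hm', ew⟩ := exists_halfLattice_re_mul_eq ha hm w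
  have hne : l' ≠ m' := by
    intro h
    rcases hl' with hl' | hl' <;> rcases hm' with hm' | hm' <;> rw [h, hm'] at hl'
    · exact h1 hl'.symm
    · exact h2 hl'.symm
    · exact h2 (by rw [hl', neg_neg])
    · exact h1 (neg_injective hl').symm
  have hind : IndepFun (fun ω => (z' * a l' ω).re) (fun ω => (w' * a m' ω).re) P :=
    (ha.iIndep.indepFun hne).comp (φ := fun u => (z' * u).re) (ψ := fun u => (w' * u).re)
      (by fun_prop) (by fun_prop)
  have e : ∫ ω, (z * a l ω).re * (w * a m ω).re ∂P =
      ∫ ω, (z' * a l' ω).re * (w' * a m' ω).re ∂P := by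
    refine integral_congr_ae ?_
    filter_upwards [ez, ew] with ω h1 h2
    rw [h1, h2]
  rw [e, hind.integral_fun_mul_eq_mul_integral
    (hasGaussianLaw_re_mul ha (ne_zero_of_mem_halfLattice l'.2) z').aemeasurable.aestronglyMeasurable
    (hasGaussianLaw_re_mul ha (ne_zero_of_mem_halfLattice m'.2) w').aemeasurable.aestronglyMeasurable,
    integral_re_mul ha (ne_zero_of_mem_halfLattice l'.2), zero_mul]

theorem inner_waveLp (ha : IsGaussianCoefficients a P) {n : ℕ} (hn : 0 < n) (x y : Torus) :
    inner ℝ (waveLp ha hn x) (waveLp ha hn y) = waveCov n (x - y) := by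
  have hne : ∀ l ∈ latticePoints n, l ≠ 0 := fun l hl => ne_zero_of_mem_latticePoints hn hl
  have hNN : (√(latticeCount n : ℝ))⁻¹ * (√(latticeCount n : ℝ))⁻¹ = (latticeCount n : ℝ)⁻¹ := by
    rw [← mul_inv, Real.mul_self_sqrt (by positivity)]
  have h1 : inner ℝ (waveLp ha hn x) (waveLp ha hn y) =
      ∫ ω, ∑ l ∈ latticePoints n, ∑ m ∈ latticePoints n, (latticeCount n : ℝ)⁻¹ *
        ((UnitAddTorus.mFourier l x * a l ω).re * (UnitAddTorus.mFourier m y * a m ω).re) ∂P := by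
    rw [inner_eq_integral_mul]
    refine integral_congr_ae ?_
    filter_upwards [coeFn_waveLp ha hn x, coeFn_waveLp ha hn y] with ω hx hy
    rw [hx, hy, wave_eq_sum, wave_eq_sum, Finset.sum_mul_sum]
    refine Finset.sum_congr rfl fun l _ => Finset.sum_congr rfl fun m _ => ?_
    rw [← hNN]
    ring
  have hint : ∀ l ∈ latticePoints n, ∀ m ∈ latticePoints n, Integrable (fun ω =>
      (latticeCount n : ℝ)⁻¹ * ((UnitAddTorus.mFourier l x * a l ω).re *
        (UnitAddTorus.mFourier m y * a m ω).re)) P := fun l hl m hm =>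
    ((memLp_re_mul ha (hne l hl) _).integrable_mul (memLp_re_mul ha (hne m hm) _)).const_mul _
  rw [h1, integral_finsetSum _ fun l hl => integrable_finsetSum _ fun m hm => hint l hl m hm]
  unfold waveCov
  rw [Finset.mul_sum]
  refine Finset.sum_congr rfl fun l hl => ?_
  rw [integral_finsetSum _ fun m hm => hint l hl m hm]
  simp only [integral_const_mul]
  rw [← Finset.mul_sum]
  congr 1
  have hl0 := hne l hl
  have hlneg : l ≠ -l := by
    intro h
    apply hl0
    funext i
    have := congrFun h i
    simp only [Pi.neg_apply] at this
    simp only [Pi.zero_apply]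
    omega
  -- Only `m = l` and `m = -l` are correlated with `l`. Each contributes half of the real part of
  -- the character at `x - y`.
  rw [Finset.sum_eq_add_of_mem l (-l) hl (neg_mem_latticePoints hl) hlneg]
  · rw [integral_re_mul_mul_re_mul ha hl0, integral_re_mul_mul_re_mul_neg ha hl0,
      UnitAddTorus.mFourier_neg, sub_eq_add_neg, mFourier_add_apply, mFourier_neg_apply]
    ring
  · intro m hm hmne
    refine integral_re_mul_mul_re_mul_of_ne ha hl0 (hne m hm) (Ne.symm hmne.1) ?_ _ _
    intro h
    exact hmne.2 (by rw [h, neg_neg])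

theorem waveCov_zero {n : ℕ} (hn : n ∈ sumsOfTwoSquares) : waveCov n 0 = 1 := by
  have hN : (latticeCount n : ℝ) ≠ 0 := by exact_mod_cast (latticeCount_pos hn).ne'
  have h : ∀ l : Fin 2 → ℤ, UnitAddTorus.mFourier l (0 : Torus) = 1 := by
    intro l
    simp only [UnitAddTorus.mFourier, ContinuousMap.coe_mk, Pi.zero_apply, fourier_eval_zero,
      Finset.prod_const_one]
  unfold waveCov
  simp only [h, Complex.one_re, Finset.sum_const, nsmul_eq_mul, mul_one]
  exact inv_mul_cancel₀ hN

theorem norm_waveLp (ha : IsGaussianCoefficients a P) {n : ℕ} (hn : 0 < n)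
    (hn2 : n ∈ sumsOfTwoSquares) (x : Torus) : ‖waveLp ha hn x‖ = 1 := by
  have h := inner_waveLp ha hn x x
  rw [real_inner_self_eq_norm_sq, sub_self, waveCov_zero hn2] at h
  nlinarith [norm_nonneg (waveLp ha hn x)]

theorem hasLaw_waveLp (ha : IsGaussianCoefficients a P) {n : ℕ} (hn : 0 < n)
    (hn2 : n ∈ sumsOfTwoSquares) (x : Torus) : HasLaw (waveLp ha hn x) (gaussianReal 0 1) P := by
  have h := hasLaw_of_mem_gaussianSpace ha (waveLp_mem_gaussianSpace ha hn x)
  have h1 : ‖waveLp ha hn x‖₊ = 1 := by ext; simp [norm_waveLp ha hn hn2 x]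
  rwa [h1, one_pow] at h

end

section

/-! ### The second moment of the approximations of the Leray measure -/

/-- The limit of the second moment of the approximations. -/
def lerayMoment (n : ℕ) : ℝ := ∫ x : Torus, originDensity (1 - waveCov n x ^ 2)

/-- A lower bound of the second moment of the approximations. -/
def lerayMomentLower (n : ℕ) (u : ℝ) : ℝ :=
  ∫ x : Torus, originDensity (1 - waveCov n x ^ 2) *
    Real.exp (-(u ^ 2 / (2 * (1 - waveCov n x ^ 2)) + u ^ 2 / 2))

theorem originDensity_nonneg (v : ℝ) : 0 ≤ originDensity v := by
  unfold originDensity; positivity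

theorem measurable_originDensity_waveCov (n : ℕ) :
    Measurable fun x : Torus => originDensity (1 - waveCov n x ^ 2) := by
  unfold originDensity
  fun_prop

theorem integrable_originDensity_waveCov {n : ℕ} (hn : n ∈ sumsOfTwoSquares) (hn0 : 0 < n) :
    Integrable fun x : Torus => originDensity (1 - waveCov n x ^ 2) :=
  (hasSum_integral_inv_sqrt n hn hn0).2.const_mul _

theorem originDensity_mul_exp_le {v : ℝ} (hv : 0 ≤ v) (u : ℝ) :
    originDensity v * Real.exp (-(u ^ 2 / (2 * v) + u ^ 2 / 2)) ≤ originDensity v :=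
  mul_le_of_le_one_right (originDensity_nonneg _)
    (Real.exp_le_one_iff.mpr (neg_nonpos.mpr (by positivity)))

theorem measurable_originDensity_mul_exp (n : ℕ) (u : ℝ) :
    Measurable fun x : Torus => originDensity (1 - waveCov n x ^ 2) *
      Real.exp (-(u ^ 2 / (2 * (1 - waveCov n x ^ 2)) + u ^ 2 / 2)) := by
  have := measurable_originDensity_waveCov n
  have h2 : Measurable (waveCov n) := (continuous_waveCov n).measurable
  fun_prop

theorem norm_originDensity_mul_exp_le {n : ℕ} (hn : n ∈ sumsOfTwoSquares) (u : ℝ) (x : Torus) :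
    ‖originDensity (1 - waveCov n x ^ 2) *
      Real.exp (-(u ^ 2 / (2 * (1 - waveCov n x ^ 2)) + u ^ 2 / 2))‖ ≤
      originDensity (1 - waveCov n x ^ 2) := by
  rw [Real.norm_of_nonneg (mul_nonneg (originDensity_nonneg _) (Real.exp_pos _).le)]
  exact originDensity_mul_exp_le (by linarith [waveCov_sq_le_one n hn x]) u

theorem integrable_originDensity_mul_exp {n : ℕ} (hn : n ∈ sumsOfTwoSquares) (hn0 : 0 < n)
    (u : ℝ) : Integrable fun x : Torus => originDensity (1 - waveCov n x ^ 2) *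
      Real.exp (-(u ^ 2 / (2 * (1 - waveCov n x ^ 2)) + u ^ 2 / 2)) :=
  (integrable_originDensity_waveCov hn hn0).mono'
    (measurable_originDensity_mul_exp n u).aestronglyMeasurable
    (Eventually.of_forall fun x => norm_originDensity_mul_exp_le hn u x)

theorem tendsto_lerayMomentLower {n : ℕ} (hn : n ∈ sumsOfTwoSquares) (hn0 : 0 < n) :
    Tendsto (lerayMomentLower n) (𝓝 0) (𝓝 (lerayMoment n)) := by
  refine tendsto_integral_filter_of_dominated_convergence
    (fun x => originDensity (1 - waveCov n x ^ 2))
    (Eventually.of_forall fun u => (measurable_originDensity_mul_exp n u).aestronglyMeasurable)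
    (Eventually.of_forall fun u => Eventually.of_forall fun x => norm_originDensity_mul_exp_le hn u x)
    (integrable_originDensity_waveCov hn hn0) (Eventually.of_forall fun x => ?_)
  have h : Continuous fun u : ℝ => originDensity (1 - waveCov n x ^ 2) *
      Real.exp (-(u ^ 2 / (2 * (1 - waveCov n x ^ 2)) + u ^ 2 / 2)) := by fun_prop
  simpa using h.tendsto 0

theorem hasSum_lerayMoment {n : ℕ} (hn : n ∈ sumsOfTwoSquares) (hn0 : 0 < n) :
    HasSum (fun q => (2 * Real.pi)⁻¹ * (centralCoeff q * ∫ x, waveCov n x ^ (2 * q)))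
      (lerayMoment n) := by
  unfold lerayMoment originDensity
  rw [integral_const_mul]
  exact (hasSum_integral_inv_sqrt n hn hn0).1.mul_left _

theorem norm_deltaApprox_le_abs (ε x : ℝ) : ‖deltaApprox ε x‖ ≤ |(2 * ε)⁻¹| := by
  unfold deltaApprox
  exact norm_indicator_le_norm_self _ _

theorem lerayApprox_eq_integral {Ω : Type*} (a : (Fin 2 → ℤ) → Ω → ℂ) (n : ℕ) (ε : ℝ) (ω : Ω)
    (h : Measurable fun x => wave a n x ω) :
    lerayApprox a n ε ω = ∫ x, deltaApprox ε (wave a n x ω) := by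
  have hm : MeasurableSet {x | |wave a n x ω| < ε} := measurableSet_lt h.abs measurable_const
  have e : (fun x => deltaApprox ε (wave a n x ω)) =
      {x | |wave a n x ω| < ε}.indicator fun _ => (2 * ε)⁻¹ := by
    funext x
    simp only [deltaApprox, Set.indicator_apply, Set.mem_Ioo, Set.mem_ofPred_eq, abs_lt]
  rw [e, integral_indicator hm, setIntegral_const, smul_eq_mul, mul_comm, lerayApprox]

variable {Ω : Type*} [MeasurableSpace Ω] {a : (Fin 2 → ℤ) → Ω → ℂ} {P : Measure Ω}

theorem measurable_wave_left (ha : IsGaussianCoefficients a P) {n : ℕ} (hn : 0 < n) (ω : Ω) :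
    Measurable fun x : Torus => wave a n x ω := by
  have h : Measurable fun x : Torus => (x, ω) := measurable_prodMk_right
  have h2 := (measurable_uncurry_wave ha hn).comp h
  exact h2

theorem measurable_wave (ha : IsGaussianCoefficients a P) {n : ℕ} (hn : 0 < n) (x : Torus) :
    Measurable (wave a n x) := by
  have h : Measurable fun ω : Ω => (x, ω) := measurable_prodMk_left
  have h2 := (measurable_uncurry_wave ha hn).comp h
  exact h2

theorem measurable_uncurry_deltaApprox_wave (ha : IsGaussianCoefficients a P) {n : ℕ} (hn : 0 < n)
    (ε : ℝ) : Measurable fun z : Ω × Torus => deltaApprox ε (wave a n z.2 z.1) := by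
  have h : Measurable fun z : Ω × Torus => (z.2, z.1) := measurable_swap
  have h2 := (measurable_deltaApprox ε).comp ((measurable_uncurry_wave ha hn).comp h)
  exact h2

theorem measurable_lerayApprox (ha : IsGaussianCoefficients a P) {n : ℕ} (hn : 0 < n) (ε : ℝ) :
    Measurable (lerayApprox a n ε) := by
  have e : lerayApprox a n ε = fun ω => ∫ x, deltaApprox ε (wave a n x ω) :=
    funext fun ω => lerayApprox_eq_integral a n ε ω (measurable_wave_left ha hn ω)
  rw [e]
  exact ((measurable_uncurry_deltaApprox_wave ha hn ε).stronglyMeasurable.integral_prod_right').measurable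

variable [IsProbabilityMeasure P]

theorem memLp_lerayApprox (ha : IsGaussianCoefficients a P) {n : ℕ} (hn : 0 < n) (ε : ℝ) :
    MemLp (lerayApprox a n ε) 2 P := by
  refine MemLp.of_bound (measurable_lerayApprox ha hn ε).aestronglyMeasurable |(2 * ε)⁻¹|
    (Eventually.of_forall fun ω => ?_)
  rw [lerayApprox, norm_mul]
  refine mul_le_of_le_one_right (norm_nonneg _) ?_
  rw [Real.norm_of_nonneg measureReal_nonneg]
  exact measureReal_le_one

theorem memLp_deltaApprox_wave (ha : IsGaussianCoefficients a P) {n : ℕ} (hn : 0 < n) (ε : ℝ)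
    (x : Torus) : MemLp (fun ω => deltaApprox ε (wave a n x ω)) 2 P :=
  MemLp.of_bound ((measurable_deltaApprox ε).comp (measurable_wave ha hn x)).aestronglyMeasurable
    |(2 * ε)⁻¹| (Eventually.of_forall fun _ => norm_deltaApprox_le_abs _ _)

/-- The approximation of the Leray measure, as an element of `L²`. -/
def lerayLp (ha : IsGaussianCoefficients a P) {n : ℕ} (hn : 0 < n) (ε : ℝ) : Lp ℝ 2 P :=
  (memLp_lerayApprox ha hn ε).toLp _

/-- The integrand of the approximation of the Leray measure, as an element of `L²`. -/
def deltaLp (ha : IsGaussianCoefficients a P) {n : ℕ} (hn : 0 < n) (ε : ℝ) (x : Torus) :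
    Lp ℝ 2 P := (memLp_deltaApprox_wave ha hn ε x).toLp _

theorem inner_deltaLp_eq (ha : IsGaussianCoefficients a P) {n : ℕ} (hn : 0 < n) (ε : ℝ)
    (x : Torus) (G : Lp ℝ 2 P) :
    inner ℝ (deltaLp ha hn ε x) G = ∫ ω, deltaApprox ε (wave a n x ω) * G ω ∂P := by
  rw [inner_eq_integral_mul]
  refine integral_congr_ae ?_
  filter_upwards [(memLp_deltaApprox_wave ha hn ε x).coeFn_toLp] with ω hω
  rw [deltaLp, hω]

/-- Fubini. It presents the approximation as a weak integral of `deltaLp` over the torus, so that no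
measurability of `deltaLp` as an `Lp`-valued map is required. -/
theorem inner_lerayLp (ha : IsGaussianCoefficients a P) {n : ℕ} (hn : 0 < n) (ε : ℝ)
    (G : Lp ℝ 2 P) : Integrable (fun x => inner ℝ (deltaLp ha hn ε x) G) ∧
      inner ℝ (lerayLp ha hn ε) G = ∫ x, inner ℝ (deltaLp ha hn ε x) G := by
  have hG : Integrable G P := (Lp.memLp G).integrable (by norm_num)
  have hi : Integrable (fun z : Ω × Torus => deltaApprox ε (wave a n z.2 z.1) * G z.1)
      (P.prod volume) :=
    (hG.comp_fst volume).bdd_mul (c := |(2 * ε)⁻¹|)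
      (measurable_uncurry_deltaApprox_wave ha hn ε).aestronglyMeasurable
      (Eventually.of_forall fun _ => norm_deltaApprox_le_abs _ _)
  simp only [inner_deltaLp_eq]
  refine ⟨hi.integral_prod_right, ?_⟩
  rw [← integral_integral_swap hi, inner_eq_integral_mul]
  refine integral_congr_ae ?_
  filter_upwards [(memLp_lerayApprox ha hn ε).coeFn_toLp] with ω hω
  rw [lerayLp, hω, lerayApprox_eq_integral a n ε ω (measurable_wave_left ha hn ω),
    integral_mul_const]

theorem inner_deltaLp_deltaLp (ha : IsGaussianCoefficients a P) {n : ℕ} (hn : 0 < n) (ε δ : ℝ)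
    (x y : Torus) : inner ℝ (deltaLp ha hn ε x) (deltaLp ha hn δ y) =
      ∫ ω, deltaApprox ε (waveLp ha hn x ω) * deltaApprox δ (waveLp ha hn y ω) ∂P := by
  rw [inner_deltaLp_eq]
  refine integral_congr_ae ?_
  filter_upwards [(memLp_deltaApprox_wave ha hn δ y).coeFn_toLp, coeFn_waveLp ha hn x,
    coeFn_waveLp ha hn y] with ω h1 h2 h3
  rw [deltaLp, h1, h2, h3]

theorem ae_waveCov_sub_sq_lt_one {n : ℕ} (hn2 : n ∈ sumsOfTwoSquares) (hn : 0 < n) (x : Torus) :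
    ∀ᵐ y : Torus, waveCov n (y - x) ^ 2 < 1 :=
  (measurePreserving_sub_right volume x).quasiMeasurePreserving.ae (ae_waveCov_sq_lt_one n hn2 hn)

theorem lerayMoment_eq_integral_sub (n : ℕ) (x : Torus) :
    lerayMoment n = ∫ y : Torus, originDensity (1 - waveCov n (y - x) ^ 2) :=
  (integral_sub_right_eq_self (fun y : Torus => originDensity (1 - waveCov n y ^ 2)) x).symm

theorem lerayMomentLower_eq_integral_sub (n : ℕ) (u : ℝ) (x : Torus) :
    lerayMomentLower n u = ∫ y : Torus, originDensity (1 - waveCov n (y - x) ^ 2) *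
      Real.exp (-(u ^ 2 / (2 * (1 - waveCov n (y - x) ^ 2)) + u ^ 2 / 2)) :=
  (integral_sub_right_eq_self (fun y : Torus => originDensity (1 - waveCov n y ^ 2) *
      Real.exp (-(u ^ 2 / (2 * (1 - waveCov n y ^ 2)) + u ^ 2 / 2))) x).symm

theorem inner_deltaLp_deltaLp_bounds (ha : IsGaussianCoefficients a P) {n : ℕ} (hn : 0 < n)
    (hn2 : n ∈ sumsOfTwoSquares) {ε δ : ℝ} (hε : 0 < ε) (hδ : 0 < δ) {x y : Torus}
    (hy : waveCov n (y - x) ^ 2 < 1) :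
    inner ℝ (deltaLp ha hn δ y) (deltaLp ha hn ε x) ≤ originDensity (1 - waveCov n (y - x) ^ 2) ∧
    originDensity (1 - waveCov n (y - x) ^ 2) * Real.exp (-((ε + δ) ^ 2 /
      (2 * (1 - waveCov n (y - x) ^ 2)) + (ε + δ) ^ 2 / 2)) ≤
      inner ℝ (deltaLp ha hn δ y) (deltaLp ha hn ε x) := by
  rw [← inner_waveLp ha hn y x] at hy ⊢
  rw [inner_deltaLp_deltaLp, add_comm ε δ]
  exact integral_deltaApprox_mul_deltaApprox_bounds ha (waveLp_mem_gaussianSpace ha hn y)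
    (waveLp_mem_gaussianSpace ha hn x) (norm_waveLp ha hn hn2 y) (norm_waveLp ha hn hn2 x) hy hδ hε

/-- The pointwise bounds are integrated over the second point. Translation invariance makes the
result independent of the first point. -/
theorem inner_deltaLp_lerayLp_bounds (ha : IsGaussianCoefficients a P) {n : ℕ} (hn : 0 < n)
    (hn2 : n ∈ sumsOfTwoSquares) {ε δ : ℝ} (hε : 0 < ε) (hδ : 0 < δ) (x : Torus) :
    inner ℝ (deltaLp ha hn ε x) (lerayLp ha hn δ) ≤ lerayMoment n ∧
    lerayMomentLower n (ε + δ) ≤ inner ℝ (deltaLp ha hn ε x) (lerayLp ha hn δ) := by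
  obtain ⟨hi, he⟩ := inner_lerayLp ha hn δ (deltaLp ha hn ε x)
  rw [real_inner_comm, he, lerayMoment_eq_integral_sub n x, lerayMomentLower_eq_integral_sub n _ x]
  have hae := ae_waveCov_sub_sq_lt_one hn2 hn x
  refine ⟨integral_mono_ae hi ((integrable_originDensity_waveCov hn2 hn).comp_sub_right x) ?_,
    integral_mono_ae ((integrable_originDensity_mul_exp hn2 hn (ε + δ)).comp_sub_right x) hi ?_⟩
  · filter_upwards [hae] with y hy using (inner_deltaLp_deltaLp_bounds ha hn hn2 hε hδ hy).1
  · filter_upwards [hae] with y hy using (inner_deltaLp_deltaLp_bounds ha hn hn2 hε hδ hy).2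

theorem inner_lerayLp_lerayLp_bounds (ha : IsGaussianCoefficients a P) {n : ℕ} (hn : 0 < n)
    (hn2 : n ∈ sumsOfTwoSquares) {ε δ : ℝ} (hε : 0 < ε) (hδ : 0 < δ) :
    inner ℝ (lerayLp ha hn ε) (lerayLp ha hn δ) ≤ lerayMoment n ∧
    lerayMomentLower n (ε + δ) ≤ inner ℝ (lerayLp ha hn ε) (lerayLp ha hn δ) := by
  have hb := inner_deltaLp_lerayLp_bounds ha hn hn2 hε hδ
  obtain ⟨hi, he⟩ := inner_lerayLp ha hn ε (lerayLp ha hn δ)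
  rw [he]
  refine ⟨?_, ?_⟩
  · calc _ ≤ ∫ _ : Torus, lerayMoment n := integral_mono hi (integrable_const _) fun x => (hb x).1
      _ = _ := by simp
  · calc _ = ∫ _ : Torus, lerayMomentLower n (ε + δ) := by simp
      _ ≤ _ := integral_mono (integrable_const _) hi fun x => (hb x).2

/-- Expanding the square, the two norms use the upper bound and only the cross term the lower one.
The right side tends to zero with `ε + δ`, which is the Cauchy property in `L²`. -/
theorem norm_lerayLp_sub_sq_le (ha : IsGaussianCoefficients a P) {n : ℕ} (hn : 0 < n)
    (hn2 : n ∈ sumsOfTwoSquares) {ε δ : ℝ} (hε : 0 < ε) (hδ : 0 < δ) :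
    ‖lerayLp ha hn ε - lerayLp ha hn δ‖ ^ 2 ≤
      2 * (lerayMoment n - lerayMomentLower n (ε + δ)) := by
  rw [norm_sub_sq_real, ← real_inner_self_eq_norm_sq, ← real_inner_self_eq_norm_sq]
  have h1 := (inner_lerayLp_lerayLp_bounds ha hn hn2 hε hε).1
  have h2 := (inner_lerayLp_lerayLp_bounds ha hn hn2 hδ hδ).1
  have h3 := (inner_lerayLp_lerayLp_bounds ha hn hn2 hε hδ).2
  linarith

theorem exists_tendsto_lerayLp (ha : IsGaussianCoefficients a P) {n : ℕ} (hn : 0 < n)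
    (hn2 : n ∈ sumsOfTwoSquares) : ∃ Z : Lp ℝ 2 P, Tendsto (lerayLp ha hn) (𝓝[>] 0) (𝓝 Z) := by
  rw [← cauchy_map_iff_exists_tendsto, cauchy_map_iff', Metric.uniformity_eq_comap_nhds_zero,
    tendsto_comap_iff]
  have hadd : Tendsto (fun z : ℝ × ℝ => z.1 + z.2) (𝓝[>] 0 ×ˢ 𝓝[>] 0) (𝓝 0) := by
    have h : Tendsto (fun z : ℝ × ℝ => z.1 + z.2) (𝓝 ((0 : ℝ), (0 : ℝ))) (𝓝 (0 + 0)) :=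
      (continuous_fst.add continuous_snd).tendsto (0, 0)
    rw [add_zero, nhds_prod_eq] at h
    exact h.mono_left (Filter.prod_mono nhdsWithin_le_nhds nhdsWithin_le_nhds)
  have hlim := ((tendsto_lerayMomentLower hn2 hn).comp hadd).const_sub (lerayMoment n)
  have hsqrt := (hlim.const_mul 2).sqrt
  rw [sub_self, mul_zero, Real.sqrt_zero] at hsqrt
  refine squeeze_zero' (Eventually.of_forall fun _ => dist_nonneg) ?_ hsqrt
  have hpos : ∀ᶠ z : ℝ × ℝ in 𝓝[>] 0 ×ˢ 𝓝[>] 0, 0 < z.1 ∧ 0 < z.2 :=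
    (eventually_mem_nhdsWithin.prod_inl _).and (eventually_mem_nhdsWithin.prod_inr _)
  filter_upwards [hpos] with z hz
  rw [Function.comp, dist_eq_norm]
  exact Real.le_sqrt_of_sq_le (norm_lerayLp_sub_sq_le ha hn hn2 hz.1 hz.2)

theorem isLerayMeasure_of_tendsto (ha : IsGaussianCoefficients a P) {n : ℕ} (hn : 0 < n)
    {Z : Lp ℝ 2 P} (hZ : Tendsto (lerayLp ha hn) (𝓝[>] 0) (𝓝 Z)) : IsLerayMeasure a P n Z := by
  have h := tendstoInMeasure_of_tendsto_Lp hZ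
  exact h.congr (fun ε => (memLp_lerayApprox ha hn ε).coeFn_toLp) EventuallyEq.rfl

theorem norm_sq_of_tendsto_lerayLp (ha : IsGaussianCoefficients a P) {n : ℕ} (hn : 0 < n)
    (hn2 : n ∈ sumsOfTwoSquares) {Z : Lp ℝ 2 P} (hZ : Tendsto (lerayLp ha hn) (𝓝[>] 0) (𝓝 Z)) :
    ‖Z‖ ^ 2 = lerayMoment n := by
  refine tendsto_nhds_unique (hZ.norm.pow 2) ?_
  have hadd : Tendsto (fun ε : ℝ => ε + ε) (𝓝[>] 0) (𝓝 0) := by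
    have h : Tendsto (fun ε : ℝ => ε + ε) (𝓝 0) (𝓝 (0 + 0)) :=
      (continuous_id.add continuous_id).tendsto 0
    rw [add_zero] at h
    exact h.mono_left nhdsWithin_le_nhds
  refine tendsto_of_tendsto_of_tendsto_of_le_of_le' ((tendsto_lerayMomentLower hn2 hn).comp hadd)
    tendsto_const_nhds ?_ ?_
  · filter_upwards [self_mem_nhdsWithin] with ε hε
    rw [← real_inner_self_eq_norm_sq]
    exact (inner_lerayLp_lerayLp_bounds ha hn hn2 hε hε).2
  · filter_upwards [self_mem_nhdsWithin] with ε hε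
    rw [← real_inner_self_eq_norm_sq]
    exact (inner_lerayLp_lerayLp_bounds ha hn hn2 hε hε).1

/-- The constant one, as an element of `L²`. -/
def oneLp (P : Measure Ω) [IsProbabilityMeasure P] : Lp ℝ 2 P := (memLp_const (1 : ℝ)).toLp _

theorem coeFn_oneLp : oneLp P =ᵐ[P] fun _ => (1 : ℝ) := MemLp.coeFn_toLp _

theorem inner_oneLp (F : Lp ℝ 2 P) : inner ℝ F (oneLp P) = ∫ ω, F ω ∂P := by
  rw [inner_eq_integral_mul]
  refine integral_congr_ae ?_
  filter_upwards [coeFn_oneLp (P := P)] with ω hω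
  rw [hω, mul_one]

theorem integral_of_tendsto_lerayLp (ha : IsGaussianCoefficients a P) {n : ℕ} (hn : 0 < n)
    (hn2 : n ∈ sumsOfTwoSquares) {Z : Lp ℝ 2 P} (hZ : Tendsto (lerayLp ha hn) (𝓝[>] 0) (𝓝 Z)) :
    ∫ ω, Z ω ∂P = (√(2 * Real.pi))⁻¹ := by
  rw [← inner_oneLp]
  refine tendsto_nhds_unique (hZ.inner tendsto_const_nhds) ?_
  have h := tendsto_integral_deltaApprox_mul_hermiteFun 0
  simp only [hermiteFun_zero, mul_one] at h
  refine h.congr fun ε => ?_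
  rw [(inner_lerayLp ha hn ε (oneLp P)).2]
  have e : ∀ x, inner ℝ (deltaLp ha hn ε x) (oneLp P) = ∫ x, deltaApprox ε x ∂gaussianReal 0 1 := by
    intro x
    rw [inner_oneLp, ← (hasLaw_waveLp ha hn hn2 x).integral_comp
      (measurable_deltaApprox ε).aestronglyMeasurable]
    refine integral_congr_ae ?_
    filter_upwards [(memLp_deltaApprox_wave ha hn ε x).coeFn_toLp, coeFn_waveLp ha hn x]
      with ω h1 h2
    rw [deltaLp, h1, Function.comp, h2]
  simp [e]

theorem variance_eq_norm_sq_sub (F : Lp ℝ 2 P) :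
    variance F P = ‖F‖ ^ 2 - (∫ ω, F ω ∂P) ^ 2 := by
  rw [variance_eq_sub (Lp.memLp F), norm_sq_eq_integral_sq]
  rfl

end

section

/-! ### The chaotic components of the Leray measure -/

variable {Ω : Type*} [MeasurableSpace Ω] {a : (Fin 2 → ℤ) → Ω → ℂ} {P : Measure Ω}
  [IsProbabilityMeasure P]

theorem memLp_hermiteFun_waveLp (ha : IsGaussianCoefficients a P) {n : ℕ} (hn : 0 < n)
    (hn2 : n ∈ sumsOfTwoSquares) (q : ℕ) (x : Torus) :
    MemLp (fun ω => hermiteFun q (waveLp ha hn x ω)) 2 P := by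
  have h := memLp_hermiteFun q
  rw [← (hasLaw_waveLp ha hn hn2 x).map_eq] at h
  exact h.comp_of_map (aemeasurable_Lp _)

/-- The Hermite polynomial of the value of the wave at a point, as an element of `L²`. -/
def hermiteLp (ha : IsGaussianCoefficients a P) {n : ℕ} (hn : 0 < n)
    (hn2 : n ∈ sumsOfTwoSquares) (q : ℕ) (x : Torus) : Lp ℝ 2 P :=
  (memLp_hermiteFun_waveLp ha hn hn2 q x).toLp _

theorem coeFn_hermiteLp (ha : IsGaussianCoefficients a P) {n : ℕ} (hn : 0 < n)
    (hn2 : n ∈ sumsOfTwoSquares) (q : ℕ) (x : Torus) :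
    hermiteLp ha hn hn2 q x =ᵐ[P] fun ω => hermiteFun q (waveLp ha hn x ω) := MemLp.coeFn_toLp _

theorem hermiteLp_mem_wienerChaos (ha : IsGaussianCoefficients a P) {n : ℕ} (hn : 0 < n)
    (hn2 : n ∈ sumsOfTwoSquares) (q : ℕ) (x : Torus) :
    hermiteLp ha hn hn2 q x ∈ wienerChaos a P q := by
  refine Submodule.le_topologicalClosure _ (Submodule.subset_span
    ⟨1, fun _ => q, fun _ => waveLp ha hn x, le_rfl, by simp,
      fun _ => waveLp_mem_gaussianSpace ha hn x, fun _ => hasLaw_waveLp ha hn hn2 x,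
      iIndepFun.of_subsingleton, ?_⟩)
  filter_upwards [coeFn_hermiteLp ha hn hn2 q x] with ω hω
  simpa [hermiteFun] using hω

/-- The product conditions to a multiple of `H_q(T(x))`, whose squared norm supplies the factorial.
-/
theorem inner_hermiteLp_of_prod (ha : IsGaussianCoefficients a P) {n : ℕ} (hn : 0 < n)
    (hn2 : n ∈ sumsOfTwoSquares) (x : Torus) {k : ℕ} (p : Fin k → ℕ) {ξ : Fin k → Lp ℝ 2 P}
    (hξ : ∀ i, ξ i ∈ gaussianSpace a P) (hlaw : ∀ i, HasLaw (ξ i) (gaussianReal 0 1) P)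
    (hind : iIndepFun (fun i => (ξ i : Ω → ℝ)) P) {F : Lp ℝ 2 P}
    (hF : ∀ᵐ ω ∂P, F ω = ∏ i, hermiteFun (p i) (ξ i ω)) :
    inner ℝ (hermiteLp ha hn hn2 (∑ i, p i) x) F =
      (∑ i, p i).factorial * ∏ i, inner ℝ (waveLp ha hn x) (ξ i) ^ p i := by
  have h := integral_comp_mul_prod_hermiteFun ha (waveLp_mem_gaussianSpace ha hn x)
    (hasLaw_waveLp ha hn hn2 x) p hξ hlaw hind ((Lp.memLp F).integrable (by norm_num)) hF
    (ψ := hermiteFun (∑ i, p i)) (continuous_hermiteFun _).measurable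
    ((memLp_hermiteFun_waveLp ha hn hn2 _ x).integrable_mul (Lp.memLp F))
    (integrable_hermiteFun_mul _ _)
  rw [integral_hermiteFun_sq, mul_comm] at h
  rw [← h, inner_eq_integral_mul]
  refine integral_congr_ae ?_
  filter_upwards [coeFn_hermiteLp ha hn hn2 (∑ i, p i) x] with ω hω
  rw [hω]

theorem inner_hermiteLp (ha : IsGaussianCoefficients a P) {n : ℕ} (hn : 0 < n)
    (hn2 : n ∈ sumsOfTwoSquares) (q : ℕ) (x y : Torus) :
    inner ℝ (hermiteLp ha hn hn2 q x) (hermiteLp ha hn hn2 q y) =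
      q.factorial * waveCov n (x - y) ^ q := by
  have h := inner_hermiteLp_of_prod ha hn hn2 x (fun _ : Fin 1 => q)
    (ξ := fun _ => waveLp ha hn y) (F := hermiteLp ha hn hn2 q y)
    (fun _ => waveLp_mem_gaussianSpace ha hn y) (fun _ => hasLaw_waveLp ha hn hn2 y)
    iIndepFun.of_subsingleton
    (by filter_upwards [coeFn_hermiteLp ha hn hn2 q y] with ω hω; simpa using hω)
  simpa [inner_waveLp] using h

/-- The squared distance is `2 q! (1 - r^q)`, with `r` taken at the difference of the points.
Continuity makes the average over the torus a Bochner integral in `L²`, which stays in the closed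
chaos. -/
theorem continuous_hermiteLp (ha : IsGaussianCoefficients a P) {n : ℕ} (hn : 0 < n)
    (hn2 : n ∈ sumsOfTwoSquares) (q : ℕ) : Continuous (hermiteLp ha hn hn2 q) := by
  refine continuous_iff_continuousAt.mpr fun y => tendsto_iff_norm_sub_tendsto_zero.mpr ?_
  have e : ∀ x, ‖hermiteLp ha hn hn2 q x - hermiteLp ha hn hn2 q y‖ =
      √(2 * q.factorial * (1 - waveCov n (x - y) ^ q)) := by
    intro x
    rw [← Real.sqrt_sq (norm_nonneg (hermiteLp ha hn hn2 q x - hermiteLp ha hn hn2 q y)),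
      norm_sub_sq_real, ← real_inner_self_eq_norm_sq, ← real_inner_self_eq_norm_sq, inner_hermiteLp,
      inner_hermiteLp, inner_hermiteLp, sub_self, sub_self, waveCov_zero hn2, one_pow]
    congr 1
    ring
  simp only [e]
  have hc : Continuous fun x : Torus => √(2 * q.factorial * (1 - waveCov n (x - y) ^ q)) := by
    have := continuous_waveCov n
    fun_prop
  have h := hc.tendsto y
  simpa [waveCov_zero hn2] using h

theorem integral_hermiteLp_mem_wienerChaos (ha : IsGaussianCoefficients a P) {n : ℕ} (hn : 0 < n)
    (hn2 : n ∈ sumsOfTwoSquares) (q : ℕ) :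
    ∫ x, hermiteLp ha hn hn2 q x ∈ wienerChaos a P q :=
  (wienerChaos a P q).convex.integral_mem (Submodule.isClosed_topologicalClosure _)
    (Eventually.of_forall fun x => hermiteLp_mem_wienerChaos ha hn hn2 q x)
    (integrable_of_continuous_torus (continuous_hermiteLp ha hn hn2 q))

theorem inner_integral_hermiteLp (ha : IsGaussianCoefficients a P) {n : ℕ} (hn : 0 < n)
    (hn2 : n ∈ sumsOfTwoSquares) (q : ℕ) (F : Lp ℝ 2 P) :
    inner ℝ (∫ x, hermiteLp ha hn hn2 q x) F = ∫ x, inner ℝ (hermiteLp ha hn hn2 q x) F := by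
  rw [real_inner_comm, ← integral_inner
    (integrable_of_continuous_torus (continuous_hermiteLp ha hn hn2 q))]
  simp only [real_inner_comm]

theorem norm_sq_integral_hermiteLp (ha : IsGaussianCoefficients a P) {n : ℕ} (hn : 0 < n)
    (hn2 : n ∈ sumsOfTwoSquares) (q : ℕ) :
    ‖∫ x, hermiteLp ha hn hn2 q x‖ ^ 2 = q.factorial * ∫ x, waveCov n x ^ q := by
  rw [← real_inner_self_eq_norm_sq, inner_integral_hermiteLp]
  have e : ∀ x, inner ℝ (hermiteLp ha hn hn2 q x) (∫ y, hermiteLp ha hn hn2 q y) =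
      q.factorial * ∫ x, waveCov n x ^ q := by
    intro x
    rw [real_inner_comm, inner_integral_hermiteLp]
    simp only [inner_hermiteLp, integral_const_mul]
    rw [integral_sub_right_eq_self (fun y => waveCov n y ^ q) x]
  simp [e]

theorem integral_coeFn_hermiteLp (ha : IsGaussianCoefficients a P) {n : ℕ} (hn : 0 < n)
    (hn2 : n ∈ sumsOfTwoSquares) {q : ℕ} (hq : q ≠ 0) (x : Torus) :
    ∫ ω, hermiteLp ha hn hn2 q x ω ∂P = 0 := by
  obtain ⟨q, rfl⟩ := Nat.exists_eq_succ_of_ne_zero hq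
  rw [integral_congr_ae (coeFn_hermiteLp ha hn hn2 _ x), ← integral_hermiteFun_succ q]
  exact (hasLaw_waveLp ha hn hn2 x).integral_comp (continuous_hermiteFun _).aestronglyMeasurable

/-- The `q`-th chaotic component of the Leray measure. -/
def lerayComponent (ha : IsGaussianCoefficients a P) {n : ℕ} (hn : 0 < n)
    (hn2 : n ∈ sumsOfTwoSquares) (q : ℕ) : Lp ℝ 2 P :=
  -- The scalar is the `q`-th Hermite coefficient of the Dirac mass at the origin.
  ((√(2 * Real.pi))⁻¹ * hermiteFun q 0 / q.factorial) • ∫ x, hermiteLp ha hn hn2 q x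

theorem inner_deltaLp_of_prod (ha : IsGaussianCoefficients a P) {n : ℕ} (hn : 0 < n)
    (hn2 : n ∈ sumsOfTwoSquares) (ε : ℝ) (x : Torus) {k : ℕ} (p : Fin k → ℕ) {ξ : Fin k → Lp ℝ 2 P}
    (hξ : ∀ i, ξ i ∈ gaussianSpace a P) (hlaw : ∀ i, HasLaw (ξ i) (gaussianReal 0 1) P)
    (hind : iIndepFun (fun i => (ξ i : Ω → ℝ)) P) {F : Lp ℝ 2 P}
    (hF : ∀ᵐ ω ∂P, F ω = ∏ i, hermiteFun (p i) (ξ i ω)) :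
    inner ℝ (deltaLp ha hn ε x) F = (∏ i, inner ℝ (waveLp ha hn x) (ξ i) ^ p i) *
      ∫ y, deltaApprox ε y * hermiteFun (∑ i, p i) y ∂gaussianReal 0 1 := by
  have hFi : Integrable F P := (Lp.memLp F).integrable (by norm_num)
  rw [inner_deltaLp_eq, ← integral_comp_mul_prod_hermiteFun ha (waveLp_mem_gaussianSpace ha hn x)
    (hasLaw_waveLp ha hn hn2 x) p hξ hlaw hind hFi hF (measurable_deltaApprox ε)
    (hFi.bdd_mul (c := |(2 * ε)⁻¹|)
      ((measurable_deltaApprox ε).comp_aemeasurable (aemeasurable_Lp _)).aestronglyMeasurable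
      (Eventually.of_forall fun _ => norm_deltaApprox_le_abs _ _))
    ((integrable_hermiteFun _).bdd_mul (c := |(2 * ε)⁻¹|)
      (measurable_deltaApprox ε).aestronglyMeasurable
      (Eventually.of_forall fun _ => norm_deltaApprox_le_abs _ _))]
  refine integral_congr_ae ?_
  filter_upwards [coeFn_waveLp ha hn x] with ω hω
  rw [hω]

/-- The candidate lies in the chaos, so it remains to see that `Z` and the candidate have the same
inner products with the generators. There, conditioning on `T(x)` separates a factor depending only
on `x` from a one-dimensional Gaussian integral, whose limit is the Hermite coefficient of the Dirac
mass. -/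
theorem chaosComponent_eq_lerayComponent (ha : IsGaussianCoefficients a P) {n : ℕ} (hn : 0 < n)
    (hn2 : n ∈ sumsOfTwoSquares) {Z : Lp ℝ 2 P} (hZ : Tendsto (lerayLp ha hn) (𝓝[>] 0) (𝓝 Z))
    (q : ℕ) : chaosComponent a P q Z = lerayComponent ha hn hn2 q := by
  have hmem : lerayComponent ha hn hn2 q ∈ wienerChaos a P q :=
    Submodule.smul_mem _ _ (integral_hermiteLp_mem_wienerChaos ha hn hn2 q)
  -- Being orthogonal to one fixed vector is a closed linear condition, so it may be checked on
  -- generators.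
  have hle : wienerChaos a P q ≤ (Submodule.span ℝ {Z - lerayComponent ha hn hn2 q})ᗮ := by
    refine Submodule.topologicalClosure_minimal _ (Submodule.span_le.mpr ?_)
      (Submodule.isClosed_orthogonal _)
    rintro F ⟨k, p, ξ, -, rfl, hξ, hlaw, hind, hF⟩
    rw [SetLike.mem_coe, Submodule.mem_orthogonal_singleton_iff_inner_right, inner_sub_left,
      sub_eq_zero]
    refine tendsto_nhds_unique (hZ.inner tendsto_const_nhds) ?_
    have hq : ((∑ i, p i).factorial : ℝ) ≠ 0 := by exact_mod_cast Nat.factorial_ne_zero _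
    have e1 : inner ℝ (lerayComponent ha hn hn2 (∑ i, p i)) F =
        (∫ x, ∏ i, inner ℝ (waveLp ha hn x) (ξ i) ^ p i) *
          ((√(2 * Real.pi))⁻¹ * hermiteFun (∑ i, p i) 0) := by
      rw [lerayComponent, real_inner_smul_left, inner_integral_hermiteLp]
      simp only [inner_hermiteLp_of_prod ha hn hn2 _ p hξ hlaw hind hF, integral_const_mul]
      field_simp
    rw [e1]
    refine ((tendsto_integral_deltaApprox_mul_hermiteFun (∑ i, p i)).const_mul _).congr fun ε => ?_
    rw [(inner_lerayLp ha hn ε F).2]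
    simp only [inner_deltaLp_of_prod ha hn hn2 ε _ p hξ hlaw hind hF, integral_mul_const]
  refine Submodule.eq_starProjection_of_mem_of_inner_eq_zero hmem fun w hw => ?_
  exact (Submodule.mem_orthogonal_singleton_iff_inner_right).mp (hle hw)

theorem variance_chaosComponent (ha : IsGaussianCoefficients a P) {n : ℕ} (hn : 0 < n)
    (hn2 : n ∈ sumsOfTwoSquares) {Z : Lp ℝ 2 P} (hZ : Tendsto (lerayLp ha hn) (𝓝[>] 0) (𝓝 Z))
    {m : ℕ} (hm : m ≠ 0) : variance (chaosComponent a P (2 * m) Z) P =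
      (2 * Real.pi)⁻¹ * (centralCoeff m * ∫ x, waveCov n x ^ (2 * m)) := by
  have hq : ((2 * m).factorial : ℝ) ≠ 0 := by exact_mod_cast Nat.factorial_ne_zero _
  rw [chaosComponent_eq_lerayComponent ha hn hn2 hZ, variance_eq_norm_sq_sub, ← inner_oneLp,
    lerayComponent, real_inner_smul_left, inner_integral_hermiteLp]
  simp only [inner_oneLp, integral_coeFn_hermiteLp ha hn hn2 (q := 2 * m) (by omega),
    integral_zero, mul_zero]
  rw [norm_smul, mul_pow, norm_sq_integral_hermiteLp, Real.norm_eq_abs, sq_abs, div_pow, mul_pow,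
    hermiteFun_two_mul_zero_sq, inv_pow, Real.sq_sqrt (by positivity)]
  field_simp
  ring

end

end ArithmeticWave

end

/-! ### The variance of the Leray measure. -/

theorem proposition1 :
    -- the constants depend on nothing but `K`, where it occurs
    ∃ (C : ℕ → ℝ) (C₁ C₂ : ℝ),
      ∀ (Ω : Type*) [MeasurableSpace Ω] (P : Measure Ω) [IsProbabilityMeasure P]
        (a : (Fin 2 → ℤ) → Ω → ℂ), ArithmeticWave.IsGaussianCoefficients a P →
      ∀ n ∈ ArithmeticWave.sumsOfTwoSquares, 0 < n →
      -- the Leray measure exists (it is almost surely unique) and is square integrable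
      ∃ Z : Lp ℝ 2 P, ArithmeticWave.IsLerayMeasure a P n Z ∧
        -- the exact variance of the second chaotic component
        variance (ArithmeticWave.chaosComponent a P 2 Z) P
          = 1 / (4 * Real.pi * ArithmeticWave.latticeCount n) ∧
        -- the variance tails
        (∀ K : ℕ, 2 ≤ K →
          Summable (fun j : ℕ =>
            variance (ArithmeticWave.chaosComponent a P (2 * (K + j)) Z) P) ∧
          ∑' j : ℕ, variance (ArithmeticWave.chaosComponent a P (2 * (K + j)) Z) P
            ≤ C K * ∫ x : ArithmeticWave.Torus, ArithmeticWave.waveCov n x ^ (2 * K)) ∧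
        ∑' j : ℕ, variance (ArithmeticWave.chaosComponent a P (2 * (2 + j)) Z) P
          ≤ C₁ / (ArithmeticWave.latticeCount n : ℝ) ^ 2 ∧
        -- the variance asymptotics
        |variance Z P - 1 / (4 * Real.pi * ArithmeticWave.latticeCount n)|
          ≤ C₂ / (ArithmeticWave.latticeCount n : ℝ) ^ 2 := by
  open ArithmeticWave in
  -- The factor `2 (2K + 1)` comes from the tail bound, and `30 = 2 · 5 · 3` combines it at `K = 2`
  -- with the bound `3 / N²` of the fourth moment.
  refine ⟨fun K => (2 * Real.pi)⁻¹ * (2 * (2 * K + 1)), (2 * Real.pi)⁻¹ * 30,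
    (2 * Real.pi)⁻¹ * 30, ?_⟩
  intro Ω _ P _ a ha n hn2 hn
  obtain ⟨Z, hZ⟩ := exists_tendsto_lerayLp ha hn hn2
  have hvar : ∀ m : ℕ, m ≠ 0 → variance (chaosComponent a P (2 * m) Z) P =
      (2 * Real.pi)⁻¹ * (centralCoeff m * ∫ x, waveCov n x ^ (2 * m)) :=
    fun m hm => variance_chaosComponent ha hn hn2 hZ hm
  have hN : (0 : ℝ) < latticeCount n := by exact_mod_cast latticeCount_pos hn2
  have hpi := Real.pi_pos
  have hsum : ∀ K : ℕ, 2 ≤ K → (fun j : ℕ => variance (chaosComponent a P (2 * (K + j)) Z) P) =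
      fun j => (2 * Real.pi)⁻¹ * (centralCoeff (K + j) * ∫ x, waveCov n x ^ (2 * (K + j))) :=
    fun K hK => funext fun j => hvar (K + j) (by omega)
  have htail : ∀ K : ℕ, 2 ≤ K → ∑' j : ℕ, variance (chaosComponent a P (2 * (K + j)) Z) P ≤
      (2 * Real.pi)⁻¹ * (2 * (2 * K + 1)) * ∫ x, waveCov n x ^ (2 * K) := by
    intro K hK
    rw [hsum K hK, tsum_mul_left, mul_assoc]
    exact mul_le_mul_of_nonneg_left (tsum_centralCoeff_mul_integral_le n hn2 hn K) (by positivity)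
  have htail2 : ∑' j : ℕ, variance (chaosComponent a P (2 * (2 + j)) Z) P ≤
      (2 * Real.pi)⁻¹ * 30 / (latticeCount n : ℝ) ^ 2 := by
    refine (htail 2 le_rfl).trans ?_
    calc _ ≤ (2 * Real.pi)⁻¹ * (2 * (2 * (2 : ℕ) + 1)) * (3 / (latticeCount n : ℝ) ^ 2) := by
          gcongr
          exact integral_waveCov_pow_four_le n hn2
      _ = _ := by push_cast; ring
  have hsecond : variance (chaosComponent a P 2 Z) P = 1 / (4 * Real.pi * latticeCount n) := by
    have h := hvar 1 one_ne_zero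
    rw [mul_one, centralCoeff_one, integral_waveCov_sq n hn2] at h
    rw [h]
    field_simp
    norm_num
  refine ⟨Z, isLerayMeasure_of_tendsto ha hn hZ, hsecond, fun K hK => ⟨?_, htail K hK⟩, htail2, ?_⟩
  · rw [hsum K hK]
    exact (summable_centralCoeff_mul_integral n hn2 hn K).mul_left _
  · have hs := hasSum_lerayMoment hn2 hn
    -- Splits off the terms `q = 0` and `q = 1`, which are the squared mean `1 / (2π)` and the
    -- variance of the second chaos. What remains is exactly the tail of the component variances.
    have h2 := hs.summable.sum_add_tsum_nat_add 2
    rw [hs.tsum_eq, Finset.sum_range_succ, Finset.sum_range_one, centralCoeff_zero,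
      centralCoeff_one, mul_one, integral_waveCov_sq n hn2] at h2
    have h3 : ∑' j, (2 * Real.pi)⁻¹ * (centralCoeff (j + 2) * ∫ x, waveCov n x ^ (2 * (j + 2))) =
        ∑' j : ℕ, variance (chaosComponent a P (2 * (2 + j)) Z) P := by
      rw [hsum 2 le_rfl]
      simp only [add_comm]
    rw [h3] at h2
    have h4 : variance Z P - 1 / (4 * Real.pi * latticeCount n) =
        ∑' j : ℕ, variance (chaosComponent a P (2 * (2 + j)) Z) P := by
      rw [variance_eq_norm_sq_sub, norm_sq_of_tendsto_lerayLp ha hn hn2 hZ,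
        integral_of_tendsto_lerayLp ha hn hn2 hZ, inv_pow, Real.sq_sqrt (by positivity), ← h2]
      simp
      field_simp
      ring
    rw [h4, abs_of_nonneg (tsum_nonneg fun j => variance_nonneg _ _)]
    exact htail2
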